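/- **Corollary (Existence of harmonic conjugates).** Let $R_1$ be a complex topological vector space and let $R_2$ be a complex linear subspace of an operator algebra (a linear subspace of a C*-algebra $A$). For a vector space $R$ write $\mathcal M(R)=\bigcup_{n\ge 1} M_n(\mathbb C)\otimes R$, and for $D\subseteq\mathcal M(R)$ put $D_n = D\cap (M_n(\mathbb C)\otimes R)$. A set $D\subseteq \mathcal M(R_1)$ is a *free set* if it is closed under direct sums $X\oplus Y$ and under unitary conjugations $X\mapsto V^*XV$; it is *open* if each $D_n$ is open, and *connected* if any two points of the same level $D_n$ are joined by a path in $D_n$. A *real free function* $f:D\to\mathcal M(R_2)$ is a map with $f(D_n)\subseteq M_n(\mathbb C)\otimes R_2$, $f(X\oplus Y)=f(X)\oplus f(Y)$, and $f(V^*XV)=V^*f(X)V$ for unitary $V$. It is a *free analytic function* if each restriction $f|_{D_n}$ is analytic, that is, continuous and complex analytic along complex lines. A real free function $u$ is *pluriharmonic* if its values are self-adjoint, each $u|_{D_n}$ is continuous and is of class $C^2$ on complex two-dimensional affine slices, and $$\Delta u(Z)[H]=\left.\frac{\partial}{\partial\overline z}\frac{\partial}{\partial z}\,u(Z+zH)\right|_{z=0}=0$$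 for all $n$, all $Z\in D_n$ and all directions $H\in M_n(\mathbb C)\otimes R_1$. Let $D\subseteq\mathcal M(R_1)$ be an open connected free set and let $u:D\to\mathcal M(R_2)$ be a pluriharmonic real free function. Then there is a free analytic function $f:D\to\mathcal M(R_2)$, defined on all of $D$, such that $$u(Z)=\operatorname{Re} f(Z)=\tfrac12\bigl(f(Z)+f(Z)^*\bigr)\qquad\text{for all } Z\in D.$$ -/

import Mathlib

open scoped Matrix Topology

namespace FreeAnalysis

/-- The sandwich `P X Q` of a matrix `X` over a complex vector space by scalar matrices. -/
def sandwich {n : ℕ} {R : Type*} [AddCommGroup R] [Module ℂ R]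
    (P : Matrix (Fin n) (Fin n) ℂ) (X : Matrix (Fin n) (Fin n) R)
    (Q : Matrix (Fin n) (Fin n) ℂ) : Matrix (Fin n) (Fin n) R :=
  Matrix.of fun i j => ∑ k, ∑ l, (P i k * Q l j) • X k l

/-- The direct sum `X ⊕ Y`, a block diagonal matrix of size `m + n`. -/
def dirSum {m n : ℕ} {R : Type*} [Zero R]
    (X : Matrix (Fin m) (Fin m) R) (Y : Matrix (Fin n) (Fin n) R) :
    Matrix (Fin (m + n)) (Fin (m + n)) R :=
  Matrix.reindex finSumFinEquiv finSumFinEquiv (Matrix.fromBlocks X 0 0 Y)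

/-- A graded subset of the matrix universe over `R`: for every size `n` a set `D n` of
`n × n` matrices with entries in `R`, that is, of elements of `M_n(ℂ) ⊗ R`. -/
abbrev GradedSet (R : Type*) : Type _ := (n : ℕ) → Set (Matrix (Fin n) (Fin n) R)

/-- A graded map between matrix universes. Only its values on a given graded set matter. -/
abbrev GradedMap (R₁ R₂ : Type*) : Type _ :=
  (n : ℕ) → Matrix (Fin n) (Fin n) R₁ → Matrix (Fin n) (Fin n) R₂

/-- A free set: closed under direct sums and under unitary conjugation.
The sizes of the matrices in the matrix universe start at one. -/
structure IsFreeSet {R : Type*} [AddCommGroup R] [Module ℂ R] (D : GradedSet R) : Prop where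
  level_zero : D 0 = ∅
  dirSum_mem : ∀ (m n : ℕ), ∀ X ∈ D m, ∀ Y ∈ D n, dirSum X Y ∈ D (m + n)
  unitary_mem : ∀ (n : ℕ), ∀ X ∈ D n, ∀ V ∈ Matrix.unitaryGroup (Fin n) ℂ,
    sandwich (star V) X V ∈ D n

/-- A graded set is open if each of its levels is open. -/
def IsOpenLevels {R : Type*} [TopologicalSpace R] (D : GradedSet R) : Prop :=
  ∀ n, IsOpen (D n)

/-- A graded set is connected if each of its levels is path connected
(levels are allowed to be empty). -/
def IsConnectedLevels {R : Type*} [TopologicalSpace R] (D : GradedSet R) : Prop :=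
  ∀ n, ∀ X ∈ D n, ∀ Y ∈ D n, JoinedIn (D n) X Y

/-- `f` is a real free function on `D` with values in the matrix universe over the
subspace `S` of `A`. -/
structure IsRealFreeFunction {R A : Type*} [AddCommGroup R] [Module ℂ R]
    [AddCommGroup A] [Module ℂ A] (D : GradedSet R) (S : Submodule ℂ A)
    (f : GradedMap R A) : Prop where
  entry_mem : ∀ (n : ℕ), ∀ X ∈ D n, ∀ i j, f n X i j ∈ S
  map_dirSum : ∀ (m n : ℕ), ∀ X ∈ D m, ∀ Y ∈ D n,
    f (m + n) (dirSum X Y) = dirSum (f m X) (f n Y)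
  map_unitary : ∀ (n : ℕ), ∀ X ∈ D n, ∀ V ∈ Matrix.unitaryGroup (Fin n) ℂ,
    f n (sandwich (star V) X V) = sandwich (star V) (f n X) V

/-- Analyticity at each level. A map on an open subset of a complex topological vector space
is analytic if it is continuous and analytic along each complex line; in finite dimension this
is the usual notion. -/
def IsAnalyticOnLevels {R A : Type*} [AddCommGroup R] [Module ℂ R] [TopologicalSpace R]
    [NormedAddCommGroup A] [NormedSpace ℂ A] (D : GradedSet R) (f : GradedMap R A) : Prop :=
  ∀ n, ContinuousOn (f n) (D n) ∧
    ∀ Z ∈ D n, ∀ (H : Matrix (Fin n) (Fin n) R) (i j : Fin n),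
      AnalyticAt ℂ (fun z : ℂ => f n (Z + z • H) i j) 0

/-- The complex Hessian `Δ u(Z)[H] = (∂/∂z̄) (∂/∂z) u(Z + z H)` at `z = 0`, that is, a quarter
of the Laplacian in the variable `z ∈ ℂ = ℝ²`. -/
noncomputable def complexHessian {R A : Type*} [AddCommGroup R] [Module ℂ R]
    [NormedAddCommGroup A] [NormedSpace ℂ A] (u : GradedMap R A) {n : ℕ}
    (Z H : Matrix (Fin n) (Fin n) R) : Matrix (Fin n) (Fin n) A :=
  Matrix.of fun i j =>
    (1 / 4 : ℝ) • Laplacian.laplacian (fun z : ℂ => u n (Z + z • H) i j) 0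

/-- Pluriharmonicity at each level: `u` has self-adjoint values, is continuous, is twice
continuously (real) differentiable on complex two-dimensional affine slices, and its complex
Hessian vanishes at all points of `D` and in all directions. -/
structure IsPluriharmonic {R A : Type*} [AddCommGroup R] [Module ℂ R] [TopologicalSpace R]
    [NormedAddCommGroup A] [NormedSpace ℂ A] [Star A] (D : GradedSet R)
    (u : GradedMap R A) : Prop where
  isHermitian : ∀ n, ∀ Z ∈ D n, (u n Z).IsHermitian
  continuousOn : ∀ n, ContinuousOn (u n) (D n)
  contDiffAt : ∀ n, ∀ Z ∈ D n, ∀ (H K : Matrix (Fin n) (Fin n) R) (i j : Fin n),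
    ContDiffAt ℝ 2 (fun p : ℂ × ℂ => u n (Z + p.1 • H + p.2 • K) i j) 0
  complexHessian_eq_zero : ∀ n, ∀ Z ∈ D n, ∀ H : Matrix (Fin n) (Fin n) R,
    complexHessian u Z H = 0

/-- The real part `(X + X*) / 2` of a matrix over a space with involution. -/
noncomputable def rePart {n : ℕ} {A : Type*} [AddCommGroup A] [Module ℂ A] [Star A]
    (X : Matrix (Fin n) (Fin n) A) : Matrix (Fin n) (Fin n) A :=
  (1 / 2 : ℂ) • (X + Xᴴ)

end FreeAnalysis

/-! If an analytic free `f` with `Re f = u` existed, its value at the block matrix with rows `(X, XT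
- TY)` and `(0, Y)` would have upper right block `f(X)T - T f(Y)`, and `u` would show half of it.
The proof reverses this: it reads off that block from `u` and rebuilds `f` from it.

Conjugating by `1 ⊕ w` with `|w| = 1` multiplies the upper right corner `tB` of a block triangular
matrix by `w`. The corresponding corner of `u` is thus a harmonic function of `t` with `φ(wt) = w
φ(t)`, and such a function is complex linear (`exists_eq_smul_of_rotation_equivariant`,
`extMap_fromBlocks_upper`). The slope `offDiag u X Y B` is complex linear in `B`. Moreover, if `s
c(z)` is harmonic along `s` constant and also along `s - z` constant, then `c` is holomorphic; hence
the slope is holomorphic in `(X, Y)` along complex lines (`offDiag_analyticAt`).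

Fix one base point `Y` and one index `o`. The matrix `h(X)` built by `halfConjugate` from `T =
E_{io}` is a substitute for `(f(X) - f(Y)_{oo}) / 2`, and the completion is `f = u + (h - h*)`. Its
real part is `u` because the correction is skew-adjoint. Its analyticity is not evident, since `u`
and `h*` are not holomorphic. Differentiating the unitary equivariance of `u` at `X ⊕ Y` along
rotations mixing the summands (`offDiag_twist_sub_star`) expresses `u - h*` through slopes with the
roles of `X` and `Y` exchanged, plus a constant, and those are holomorphic
(`add_halfConjugate_sub_star`). Freeness of `f` holds because `h` uses the same `Y` and `o` at every
level. -/

set_option linter.unusedSectionVars false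

namespace FreeAnalysis

/-! ### Vector-valued harmonic functions of one complex variable. -/

section Harmonic

open Complex Metric

variable {E : Type*} [NormedAddCommGroup E] [NormedSpace ℂ E]

/-- A holomorphic function on a disc that is invariant under rotations is constant. -/
theorem eq_center_of_rotation_invariant [CompleteSpace E] {h : ℂ → E} {r : ℝ}
    (hd : DifferentiableOn ℂ h (ball 0 r))
    (hrot : ∀ w t : ℂ, ‖w‖ = 1 → t ∈ ball (0 : ℂ) r → h (w * t) = h t)
    {t : ℂ} (ht : t ∈ ball (0 : ℂ) r) : h t = h 0 := by
  rcases eq_or_ne t 0 with rfl | h0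
  · rfl
  have hpos : 0 < ‖t‖ := norm_pos_iff.2 h0
  have hsub : closedBall (0 : ℂ) |‖t‖| ⊆ ball 0 r := by
    rw [abs_of_pos hpos]
    exact closedBall_subset_ball (by simpa using ht)
  have h1 : Real.circleAverage h 0 ‖t‖ = h 0 :=
    (hd.diffContOnCl_ball hsub).circleAverage
  have h2 : Real.circleAverage h 0 ‖t‖ = h t := by
    refine Real.circleAverage_const_on_circle fun z hz => ?_
    have hz' : ‖z‖ = ‖t‖ := by simpa using hz
    have := hrot (z / t) t (by simp [hz', hpos.ne']) ht
    rwa [div_mul_cancel₀ _ h0] at this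
  rw [← h2, h1]

/-- The function is `2 ∂f`. Its Cauchy-Riemann equation is the vanishing of the Laplacian combined
with the symmetry of the second derivative. -/
theorem harmonic_complex_partial_differentiableAt {f : ℂ → E} {x : ℂ}
    (hf : InnerProductSpace.HarmonicAt f x) :
    DifferentiableAt ℂ (fun z => fderiv ℝ f z 1 - I • fderiv ℝ f z I) x := by
  have h₁ := hf.1
  have hd : DifferentiableAt ℝ (fderiv ℝ f) x :=
    (h₁.fderiv_right (m := 1) (by norm_num)).differentiableAt (by norm_num)
  refine differentiableAt_complex_iff_differentiableAt_real.2 ⟨by fun_prop, ?_⟩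
  have key : ∀ v : ℂ, fderiv ℝ (fun z => fderiv ℝ f z 1 - I • fderiv ℝ f z I) x v
      = fderiv ℝ (fderiv ℝ f) x v 1 - I • fderiv ℝ (fderiv ℝ f) x v I := by
    intro v
    have e : HasFDerivAt (fun z => fderiv ℝ f z 1 - I • fderiv ℝ f z I)
        (((ContinuousLinearMap.apply ℝ E (1 : ℂ)).comp (fderiv ℝ (fderiv ℝ f) x)) -
          I • ((ContinuousLinearMap.apply ℝ E I).comp (fderiv ℝ (fderiv ℝ f) x))) x := by
      refine HasFDerivAt.sub ?_ (HasFDerivAt.const_smul ?_ I)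
      · exact (ContinuousLinearMap.apply ℝ E (1 : ℂ)).hasFDerivAt.comp x hd.hasFDerivAt
      · exact (ContinuousLinearMap.apply ℝ E I).hasFDerivAt.comp x hd.hasFDerivAt
    rw [e.fderiv]; simp
  have hsymm : fderiv ℝ (fderiv ℝ f) x 1 I = fderiv ℝ (fderiv ℝ f) x I 1 :=
    (h₁.isSymmSndFDerivAt (by simp)) 1 I
  have hlap : fderiv ℝ (fderiv ℝ f) x 1 1 + fderiv ℝ (fderiv ℝ f) x I I = 0 := by
    have := hf.2.self_of_nhds
    rw [InnerProductSpace.laplacian_eq_iteratedFDeriv_complexPlane] at this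
    simpa [iteratedFDeriv_two_apply] using this
  rw [key, key, hsymm, smul_sub, smul_smul, I_mul_I, neg_one_smul, sub_neg_eq_add,
    eq_neg_of_add_eq_zero_left hlap, smul_neg]
  abel

/-- A harmonic function on a disc that satisfies `φ (w t) = w φ t` for `|w| = 1` is
complex linear. -/
theorem exists_eq_smul_of_rotation_equivariant [CompleteSpace E] {φ : ℂ → E} {r : ℝ}
    (hh : InnerProductSpace.HarmonicOnNhd φ (ball 0 r))
    (hrot : ∀ w t : ℂ, ‖w‖ = 1 → t ∈ ball (0 : ℂ) r → φ (w * t) = w • φ t) :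
    ∃ c : E, ∀ t ∈ ball (0 : ℂ) r, φ t = t • c := by
  rcases le_or_gt r 0 with hr | hr
  · exact ⟨0, fun t ht => absurd ht (by simp [ball_eq_empty.2 hr])⟩
  have hdφ : ∀ z ∈ ball (0 : ℂ) r, DifferentiableAt ℝ φ z := fun z hz =>
    (hh z hz).1.differentiableAt (by norm_num)
  have hw_mem : ∀ w z : ℂ, ‖w‖ = 1 → z ∈ ball (0 : ℂ) r → w * z ∈ ball (0 : ℂ) r := by
    intro w z hw hz
    simpa [hw] using hz
  set h : ℂ → E := fun z => fderiv ℝ φ z 1 - I • fderiv ℝ φ z I with hh_def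
  have hhd : DifferentiableOn ℂ h (ball 0 r) := fun z hz =>
    (harmonic_complex_partial_differentiableAt (hh z hz)).differentiableWithinAt
  -- Both sides arise by differentiating the equivariance `φ(wt) = w φ(t)` at `z`.
  have hD : ∀ w z v : ℂ, ‖w‖ = 1 → z ∈ ball (0 : ℂ) r →
      fderiv ℝ φ (w * z) (w * v) = w • fderiv ℝ φ z v := by
    intro w z v hw hz
    have e1 : HasFDerivAt (fun t => φ (w * t))
        ((fderiv ℝ φ (w * z)).comp (w • (ContinuousLinearMap.id ℝ ℂ))) z :=
      HasFDerivAt.comp (f := fun t => w * t) z (hdφ _ (hw_mem w z hw hz)).hasFDerivAt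
        ((hasFDerivAt_id (𝕜 := ℝ) z).const_smul w)
    have e2 : HasFDerivAt (fun t => φ (w * t)) (w • fderiv ℝ φ z) z := by
      refine ((hdφ z hz).hasFDerivAt.const_smul w).congr_of_eventuallyEq ?_
      filter_upwards [isOpen_ball.mem_nhds hz] with t ht using hrot w t hw ht
    simpa using congrArg (fun L => L v) (e1.unique e2)
  -- The chain rule for `∂` gives `w (∂φ)(wt) = w ∂φ(t)`, so the holomorphic function `h` is
  -- rotation invariant.
  have hconst : ∀ z ∈ ball (0 : ℂ) r, h z = h 0 := fun z hz => by
    refine eq_center_of_rotation_invariant hhd (fun w t hw ht => ?_) hz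
    have hw0 : w ≠ 0 := by rintro rfl; simp at hw
    have e1 : w • h (w * t) = w • h t := by
      have a1 := hD w t 1 hw ht
      have a2 := hD w t I hw ht
      have b : ∀ x : ℂ, fderiv ℝ φ (w * t) x
          = x.re • fderiv ℝ φ (w * t) 1 + x.im • fderiv ℝ φ (w * t) I := by
        intro x
        rw [← map_smul, ← map_smul, ← map_add]
        congr 1
        apply Complex.ext <;> simp
      rw [b] at a1 a2
      simp only [hh_def, smul_sub, smul_comm w I, ← a1, ← a2]
      simp only [← Complex.coe_smul, smul_add, smul_smul, mul_one, mul_re, mul_im, I_re,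
        I_im, mul_zero, zero_sub, add_zero]
      set p := fderiv ℝ φ (w * t) 1
      set q := fderiv ℝ φ (w * t) I
      have hw' : w = w.re + w.im * I := (re_add_im w).symm
      conv_lhs => rw [hw']
      match_scalars
      · ring
      · linear_combination (-(w.im : ℂ)) * I_mul_I
    exact smul_right_injective E hw0 e1
  obtain ⟨c, hc0⟩ : ∃ c : E, (2 : ℂ) • c = h 0 :=
    ⟨(1 / 2 : ℂ) • h 0, by rw [smul_smul]; norm_num⟩
  refine ⟨c, ?_⟩
  -- Since `∂φ = c`, the remainder `φ(z) - z c` is antiholomorphic, and `m` is its holomorphic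
  -- reflection. It satisfies `m(wz) = w⁻¹ m(z)`, so `z m(z)` is rotation invariant and therefore
  -- equal to its value `0` at the origin.
  set m : ℂ → E := fun z => φ (starRingEnd ℂ z) - (starRingEnd ℂ z) • c with hm_def
  have hconj_mem : ∀ z ∈ ball (0 : ℂ) r, starRingEnd ℂ z ∈ ball (0 : ℂ) r := by
    intro z hz
    simpa using hz
  have hmd : DifferentiableOn ℂ (fun z => z • m z) (ball 0 r) := by
    refine DifferentiableOn.smul differentiableOn_id fun z hz => ?_
    refine DifferentiableAt.differentiableWithinAt ?_
    have e : HasFDerivAt m (((fderiv ℝ φ (starRingEnd ℂ z)).comp (conjCLE : ℂ →L[ℝ] ℂ)) -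
        ((conjCLE : ℂ →L[ℝ] ℂ).smulRight c)) z := by
      refine HasFDerivAt.sub ?_ ?_
      · exact HasFDerivAt.comp (f := fun t => starRingEnd ℂ t) z
          (hdφ _ (hconj_mem z hz)).hasFDerivAt (conjCLE : ℂ →L[ℝ] ℂ).hasFDerivAt
      · exact (conjCLE : ℂ →L[ℝ] ℂ).hasFDerivAt.smul_const c
    refine differentiableAt_complex_iff_differentiableAt_real.2 ⟨e.differentiableAt, ?_⟩
    rw [e.fderiv]
    have hc := hconst _ (hconj_mem z hz)
    have hc2 : fderiv ℝ φ (starRingEnd ℂ z) 1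
        = (2 : ℂ) • c + I • fderiv ℝ φ (starRingEnd ℂ z) I := by
      rw [hc0, ← hc]
      simp [hh_def]
    simp only [_root_.sub_apply, ContinuousLinearMap.comp_apply,
      ContinuousLinearMap.smulRight_apply, ContinuousLinearEquiv.coe_coe, conjCLE_apply, conj_I,
      map_one, map_neg, hc2]
    match_scalars
    · linear_combination (-1 : ℂ) * I_mul_I
    · ring
  have hmrot : ∀ w t : ℂ, ‖w‖ = 1 → t ∈ ball (0 : ℂ) r → (w * t) • m (w * t) = t • m t := by
    intro w t hw ht
    have hw' : w * starRingEnd ℂ w = 1 := by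
      rw [mul_conj, normSq_eq_norm_sq, hw]; norm_num
    have := hrot (starRingEnd ℂ w) (starRingEnd ℂ t) (by simpa using hw) (hconj_mem t ht)
    simp only [hm_def, map_mul, this, mul_smul]
    rw [← smul_sub, smul_comm t, smul_smul, hw', one_smul]
  have hm0 : ∀ z ∈ ball (0 : ℂ) r, z ≠ 0 → m z = 0 := by
    intro z hz hz0
    have := eq_center_of_rotation_invariant hmd hmrot hz
    simpa [hz0] using this
  intro t ht
  rcases eq_or_ne t 0 with rfl | ht0
  -- At the origin the previous argument is empty; the rotation by `-1` gives `φ(0) = -φ(0)`.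
  · have := hrot (-1) 0 (by simp) ht
    simp only [mul_zero, neg_smul, one_smul] at this
    have h2 : (2 : ℂ) • φ 0 = 0 := by rw [two_smul]; nth_rw 1 [this]; simp
    simpa using h2
  · have := hm0 _ (hconj_mem t ht) (by simpa using ht0)
    simpa [hm_def, sub_eq_zero] using this

/-- If `c` and `(s + ζ) c` are both harmonic to first order at a point then `c` satisfies the
Cauchy-Riemann equations there. -/
theorem differentiableAt_of_laplacian_smul_eq_zero {c : ℂ → E} {x s : ℂ}
    (hc : ContDiffAt ℝ 2 c x) (h1 : Laplacian.laplacian c x = 0)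
    (h2 : Laplacian.laplacian (fun ζ => (s + (ζ - x)) • c ζ) x = 0) :
    DifferentiableAt ℂ c x := by
  have hd : DifferentiableAt ℝ c x := hc.differentiableAt (by norm_num)
  have hd2 : DifferentiableAt ℝ (fderiv ℝ c) x :=
    (hc.fderiv_right (m := 1) (by norm_num)).differentiableAt (by norm_num)
  have hl1 : fderiv ℝ (fderiv ℝ c) x 1 1 + fderiv ℝ (fderiv ℝ c) x I I = 0 := by
    rw [InnerProductSpace.laplacian_eq_iteratedFDeriv_complexPlane] at h1
    simpa [iteratedFDeriv_two_apply] using h1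
  have hp : ∀ z : ℂ, HasFDerivAt (fun ζ : ℂ => s + (ζ - x)) (ContinuousLinearMap.id ℝ ℂ) z :=
    fun z => ((hasFDerivAt_id z).sub_const x).const_add s
  have hf1 : (fderiv ℝ fun ζ => (s + (ζ - x)) • c ζ) =ᶠ[𝓝 x] fun ζ =>
      (s + (ζ - x)) • fderiv ℝ c ζ + (ContinuousLinearMap.lsmul ℝ ℂ : ℂ →L[ℝ] E →L[ℝ] E).flip (c ζ) := by
    have := hc.eventually (by simp)
    filter_upwards [this] with ζ hζ
    refine ((hp ζ).smul (hζ.differentiableAt (by norm_num)).hasFDerivAt).fderiv.trans ?_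
    congr 1
  have hl2 : ∀ v : ℂ, iteratedFDeriv ℝ 2 (fun ζ => (s + (ζ - x)) • c ζ) x ![v, v]
      = s • fderiv ℝ (fderiv ℝ c) x v v + (2 : ℂ) • v • fderiv ℝ c x v := by
    intro v
    rw [iteratedFDeriv_two_apply, hf1.fderiv_eq]
    have e : HasFDerivAt (fun ζ => (s + (ζ - x)) • fderiv ℝ c ζ +
        (ContinuousLinearMap.lsmul ℝ ℂ : ℂ →L[ℝ] E →L[ℝ] E).flip (c ζ))
        (((s + (x - x)) • fderiv ℝ (fderiv ℝ c) x +
          (ContinuousLinearMap.id ℝ ℂ).smulRight (fderiv ℝ c x)) +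
          ((ContinuousLinearMap.lsmul ℝ ℂ : ℂ →L[ℝ] E →L[ℝ] E).flip.comp
            (fderiv ℝ c x))) x := by
      refine HasFDerivAt.add ((hp x).smul hd2.hasFDerivAt) ?_
      exact (ContinuousLinearMap.lsmul ℝ ℂ :
        ℂ →L[ℝ] E →L[ℝ] E).flip.hasFDerivAt.comp x hd.hasFDerivAt
    rw [e.fderiv]
    simp [two_smul, add_assoc]
  refine differentiableAt_complex_iff_differentiableAt_real.2 ⟨hd, ?_⟩
  rw [InnerProductSpace.laplacian_eq_iteratedFDeriv_complexPlane] at h2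
  simp only [hl2] at h2
  -- In the Leibniz expansion of the second Laplacian the term `s Δc` vanishes and only the cross
  -- term, a multiple of `∂̄c`, is left.
  have h3 : (2 : ℂ) • (fderiv ℝ c x 1 + I • fderiv ℝ c x I) = 0 := by
    rw [← h2, ← sub_eq_zero]
    have : s • fderiv ℝ (fderiv ℝ c) x 1 1 + s • fderiv ℝ (fderiv ℝ c) x I I = 0 := by
      rw [← smul_add, hl1, smul_zero]
    rw [← neg_eq_zero, ← this]
    module
  have h4 : fderiv ℝ c x 1 + I • fderiv ℝ c x I = 0 := by
    rw [← smul_right_injective E (two_ne_zero (α := ℂ)) |>.eq_iff, h3, smul_zero]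
  have h5 : fderiv ℝ c x 1 = - (I • fderiv ℝ c x I) := eq_neg_of_add_eq_zero_left h4
  rw [h5, smul_neg, smul_smul, I_mul_I]; simp

end Harmonic

/-! ### Two-sided multiplication by scalar matrices. -/

/-- The product `P X Q` of a matrix `X` over a complex vector space with scalar matrices. -/
def tripleProd {a b c d R : Type*} [Fintype b] [Fintype c] [AddCommGroup R] [Module ℂ R]
    (P : Matrix a b ℂ) (X : Matrix b c R) (Q : Matrix c d ℂ) : Matrix a d R :=
  Matrix.of fun i j => ∑ k, ∑ l, (P i k * Q l j) • X k l

section TripleProd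

variable {a b c d R : Type*} [Fintype b] [Fintype c] [AddCommGroup R] [Module ℂ R]

theorem tripleProd_apply (P : Matrix a b ℂ) (X : Matrix b c R) (Q : Matrix c d ℂ) (i : a) (j : d) :
    tripleProd P X Q i j = ∑ k, ∑ l, (P i k * Q l j) • X k l := rfl

theorem tripleProd_add (P : Matrix a b ℂ) (X Y : Matrix b c R) (Q : Matrix c d ℂ) :
    tripleProd P (X + Y) Q = tripleProd P X Q + tripleProd P Y Q := by
  ext i j
  simp [tripleProd_apply, Finset.sum_add_distrib]

theorem tripleProd_sub (P : Matrix a b ℂ) (X Y : Matrix b c R) (Q : Matrix c d ℂ) :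
    tripleProd P (X - Y) Q = tripleProd P X Q - tripleProd P Y Q := by
  ext i j
  simp [tripleProd_apply, smul_sub, Finset.sum_sub_distrib]

theorem tripleProd_smul (z : ℂ) (P : Matrix a b ℂ) (X : Matrix b c R) (Q : Matrix c d ℂ) :
    tripleProd P (z • X) Q = z • tripleProd P X Q := by
  ext i j
  simp [tripleProd_apply, Finset.smul_sum, smul_comm z]

@[simp] theorem tripleProd_zero_mid (P : Matrix a b ℂ) (Q : Matrix c d ℂ) :
    tripleProd P (0 : Matrix b c R) Q = 0 := by
  ext i j
  simp [tripleProd_apply]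

@[simp] theorem tripleProd_zero_left (X : Matrix b c R) (Q : Matrix c d ℂ) :
    tripleProd (0 : Matrix a b ℂ) X Q = 0 := by
  ext i j
  simp [tripleProd_apply]

@[simp] theorem tripleProd_zero_right (P : Matrix a b ℂ) (X : Matrix b c R) :
    tripleProd P X (0 : Matrix c d ℂ) = 0 := by
  ext i j
  simp [tripleProd_apply]

theorem tripleProd_add_left (P P' : Matrix a b ℂ) (X : Matrix b c R) (Q : Matrix c d ℂ) :
    tripleProd (P + P') X Q = tripleProd P X Q + tripleProd P' X Q := by
  ext i j
  simp [tripleProd_apply, add_mul, add_smul, Finset.sum_add_distrib]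

theorem tripleProd_add_right (P : Matrix a b ℂ) (X : Matrix b c R) (Q Q' : Matrix c d ℂ) :
    tripleProd P X (Q + Q') = tripleProd P X Q + tripleProd P X Q' := by
  ext i j
  simp [tripleProd_apply, mul_add, add_smul, Finset.sum_add_distrib]

theorem tripleProd_smul_left (z : ℂ) (P : Matrix a b ℂ) (X : Matrix b c R) (Q : Matrix c d ℂ) :
    tripleProd (z • P) X Q = z • tripleProd P X Q := by
  ext i j
  simp [tripleProd_apply, Finset.smul_sum, mul_assoc, mul_smul]

theorem tripleProd_smul_right (z : ℂ) (P : Matrix a b ℂ) (X : Matrix b c R) (Q : Matrix c d ℂ) :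
    tripleProd P X (z • Q) = z • tripleProd P X Q := by
  ext i j
  simp [tripleProd_apply, Finset.smul_sum, mul_left_comm _ z, mul_smul]

theorem tripleProd_tripleProd {e f : Type*} [Fintype a] [Fintype d] (P' : Matrix e a ℂ)
    (P : Matrix a b ℂ) (X : Matrix b c R) (Q : Matrix c d ℂ) (Q' : Matrix d f ℂ) :
    tripleProd P' (tripleProd P X Q) Q' = tripleProd (P' * P) X (Q * Q') := by
  ext i j
  simp only [tripleProd_apply, Matrix.mul_apply, Finset.smul_sum, Finset.sum_mul, Finset.mul_sum,
    Finset.sum_smul, smul_smul]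
  have : ∀ x y, ∑ k, ∑ l, (P' i x * Q' y j * (P x k * Q l y)) • X k l
      = ∑ k, ∑ l, (P' i x * P x k * (Q l y * Q' y j)) • X k l := fun x y =>
    Finset.sum_congr rfl fun k _ => Finset.sum_congr rfl fun l _ => by congr 1; ring
  simp only [this]
  rw [Finset.sum_congr rfl fun x _ => Finset.sum_comm, Finset.sum_comm]
  refine Finset.sum_congr rfl fun k _ => ?_
  rw [Finset.sum_congr rfl fun x _ => Finset.sum_comm, Finset.sum_comm]
  exact Finset.sum_congr rfl fun l _ => Finset.sum_comm

theorem tripleProd_diagonal [DecidableEq b] [DecidableEq c] (p : b → ℂ) (X : Matrix b c R)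
    (q : c → ℂ) (i : b) (j : c) :
    tripleProd (Matrix.diagonal p) X (Matrix.diagonal q) i j = (p i * q j) • X i j := by
  rw [tripleProd_apply, Finset.sum_eq_single i, Finset.sum_eq_single j]
  · simp
  · intro l _ hl; simp [hl]
  · simp
  · intro k _ hk; simp [hk.symm]
  · simp

theorem tripleProd_one_one [DecidableEq b] [DecidableEq c] (X : Matrix b c R) :
    tripleProd 1 X 1 = X := by
  ext i j
  rw [← Matrix.diagonal_one, ← Matrix.diagonal_one, tripleProd_diagonal]; simp

theorem tripleProd_one_left [DecidableEq b] (X : Matrix b c R) (Q : Matrix c d ℂ) (i : b) (j : d) :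
    tripleProd 1 X Q i j = ∑ l, Q l j • X i l := by
  rw [tripleProd_apply, Finset.sum_eq_single i]
  · simp
  · intro k _ hk; simp [Matrix.one_apply_ne' hk]
  · simp

theorem tripleProd_one_right [DecidableEq c] (P : Matrix a b ℂ) (X : Matrix b c R) (i : a) (j : c) :
    tripleProd P X 1 i j = ∑ k, P i k • X k j := by
  rw [tripleProd_apply]
  refine Finset.sum_congr rfl fun k _ => ?_
  rw [Finset.sum_eq_single j]
  · simp
  · intro l _ hl; simp [Matrix.one_apply_ne hl]
  · simp

theorem tripleProd_submatrix {a' b' c' d' : Type*} [Fintype b'] [Fintype c']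
    (P : Matrix a b ℂ) (X : Matrix b c R) (Q : Matrix c d ℂ) (f : a' → a) (g : b' ≃ b)
    (h : c' ≃ c) (k : d' → d) :
    tripleProd (P.submatrix f g) (X.submatrix g h) (Q.submatrix h k)
      = (tripleProd P X Q).submatrix f k := by
  ext i j
  simp only [tripleProd_apply, Matrix.submatrix_apply]
  rw [← g.sum_comp]
  exact Finset.sum_congr rfl fun x _ => h.sum_comp fun y => (P (f i) (g x) * Q y (k j)) • X (g x) y

theorem tripleProd_fromBlocks {a' b' c' d' : Type*} [Fintype b'] [Fintype c']
    (P : Matrix a b ℂ) (P' : Matrix a' b' ℂ) (X : Matrix b c R) (B : Matrix b c' R)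
    (C : Matrix b' c R) (Y : Matrix b' c' R) (Q : Matrix c d ℂ) (Q' : Matrix c' d' ℂ) :
    tripleProd (Matrix.fromBlocks P 0 0 P') (Matrix.fromBlocks X B C Y)
      (Matrix.fromBlocks Q 0 0 Q') = Matrix.fromBlocks (tripleProd P X Q) (tripleProd P B Q')
        (tripleProd P' C Q) (tripleProd P' Y Q') := by
  ext (i | i) (j | j) <;> simp [tripleProd_apply]

end TripleProd

/-! ### Free sets and free functions over arbitrary finite index types, so that blocks are indexed
by sums. -/

/-- The members of a graded set with rows and columns indexed by an arbitrary finite type. -/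
def extSet {R : Type*} (D : GradedSet R) (ι : Type) [Fintype ι] : Set (Matrix ι ι R) :=
  {X | X.submatrix (Fintype.equivFin ι).symm (Fintype.equivFin ι).symm ∈ D (Fintype.card ι)}

/-- A graded map on matrices with rows and columns indexed by an arbitrary finite type. -/
noncomputable def extMap {R₁ R₂ : Type*} (u : GradedMap R₁ R₂) (ι : Type) [Fintype ι]
    (X : Matrix ι ι R₁) : Matrix ι ι R₂ :=
  (u (Fintype.card ι) (X.submatrix (Fintype.equivFin ι).symm (Fintype.equivFin ι).symm)).submatrix
    (Fintype.equivFin ι) (Fintype.equivFin ι)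

theorem isOpen_extSet {R : Type*} [TopologicalSpace R] {D : GradedSet R} {ι : Type} [Fintype ι]
    (hD : IsOpenLevels D) : IsOpen (extSet D ι) :=
  (hD _).preimage (by fun_prop)

section Extension

variable {R A : Type*} [AddCommGroup R] [Module ℂ R] {D : GradedSet R}

/-- The matrix of a permutation, which permutes the columns. -/
def permUnitary {n : ℕ} (σ : Equiv.Perm (Fin n)) : Matrix (Fin n) (Fin n) ℂ :=
  Matrix.of fun l j => if l = σ j then 1 else 0

theorem permUnitary_mem {n : ℕ} (σ : Equiv.Perm (Fin n)) :
    permUnitary σ ∈ Matrix.unitaryGroup (Fin n) ℂ := by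
  rw [Matrix.mem_unitaryGroup_iff']
  ext i j
  simp [permUnitary, Matrix.mul_apply, Matrix.star_apply, Matrix.one_apply, eq_comm]

theorem sandwich_permUnitary {R : Type*} [AddCommGroup R] [Module ℂ R] {n : ℕ}
    (σ : Equiv.Perm (Fin n)) (X : Matrix (Fin n) (Fin n) R) :
    sandwich (star (permUnitary σ)) X (permUnitary σ) = X.submatrix σ σ := by
  ext i j
  simp only [sandwich, permUnitary, Matrix.of_apply, Matrix.star_apply, Matrix.submatrix_apply]
  rw [Finset.sum_eq_single (σ i), Finset.sum_eq_single (σ j)]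
  · simp
  · intro l _ hl; simp [hl]
  · simp
  · intro k _ hk; simp [hk]
  · simp

theorem IsFreeSet.submatrix_mem (hD : IsFreeSet D) {n : ℕ} (σ : Equiv.Perm (Fin n))
    {X : Matrix (Fin n) (Fin n) R} (hX : X ∈ D n) : X.submatrix σ σ ∈ D n := by
  rw [← sandwich_permUnitary]
  exact hD.unitary_mem n X hX _ (permUnitary_mem σ)

theorem IsRealFreeFunction.map_submatrix [AddCommGroup A] [Module ℂ A] {S : Submodule ℂ A}
    {u : GradedMap R A} (hu : IsRealFreeFunction D S u) {n : ℕ} (σ : Equiv.Perm (Fin n))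
    {X : Matrix (Fin n) (Fin n) R} (hX : X ∈ D n) :
    u n (X.submatrix σ σ) = (u n X).submatrix σ σ := by
  rw [← sandwich_permUnitary, ← sandwich_permUnitary]
  exact hu.map_unitary n X hX _ (permUnitary_mem σ)

variable {ι κ : Type} [Fintype ι] [Fintype κ]

/-- Two enumerations of the index type differ by a permutation, and permutation matrices are
unitary, so the enumeration chosen in `extSet` is immaterial. -/
theorem IsFreeSet.mem_extSet_iff (hD : IsFreeSet D) {n : ℕ} (e : ι ≃ Fin n) {X : Matrix ι ι R} :
    X ∈ extSet D ι ↔ X.submatrix e.symm e.symm ∈ D n := by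
  obtain rfl : n = Fintype.card ι := by simpa using (Fintype.card_congr e).symm
  have h1 : X.submatrix e.symm e.symm = (X.submatrix (Fintype.equivFin ι).symm
      (Fintype.equivFin ι).symm).submatrix (e.symm.trans (Fintype.equivFin ι))
        (e.symm.trans (Fintype.equivFin ι)) := by
    ext; simp
  have h2 : X.submatrix (Fintype.equivFin ι).symm (Fintype.equivFin ι).symm
      = (X.submatrix e.symm e.symm).submatrix ((Fintype.equivFin ι).symm.trans e)
        ((Fintype.equivFin ι).symm.trans e) := by
    ext; simp
  constructor
  · intro h
    rw [h1]
    exact hD.submatrix_mem _ h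
  · intro h
    change _ ∈ D _
    rw [h2]
    exact hD.submatrix_mem _ h

theorem IsRealFreeFunction.extMap_eq [AddCommGroup A] [Module ℂ A] {S : Submodule ℂ A}
    {u : GradedMap R A} (hu : IsRealFreeFunction D S u) {n : ℕ} (e : ι ≃ Fin n)
    {X : Matrix ι ι R} (hX : X ∈ extSet D ι) :
    extMap u ι X = (u n (X.submatrix e.symm e.symm)).submatrix e e := by
  obtain rfl : n = Fintype.card ι := by simpa using (Fintype.card_congr e).symm
  have h1 : X.submatrix e.symm e.symm = (X.submatrix (Fintype.equivFin ι).symm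
      (Fintype.equivFin ι).symm).submatrix (e.symm.trans (Fintype.equivFin ι))
        (e.symm.trans (Fintype.equivFin ι)) := by
    ext; simp
  rw [h1, hu.map_submatrix _ hX]
  ext; simp [extMap]

theorem IsFreeSet.mem_extSet_fin (hD : IsFreeSet D) {n : ℕ} {X : Matrix (Fin n) (Fin n) R} :
    X ∈ extSet D (Fin n) ↔ X ∈ D n := hD.mem_extSet_iff (Equiv.refl _)

theorem IsFreeSet.submatrix_mem_extSet_iff (hD : IsFreeSet D) (e : κ ≃ ι) {X : Matrix ι ι R} :
    X.submatrix e e ∈ extSet D κ ↔ X ∈ extSet D ι := by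
  rw [hD.mem_extSet_iff (e.trans (Fintype.equivFin ι))]
  change _ ↔ _ ∈ D _
  convert Iff.rfl using 2
  ext; simp

theorem IsFreeSet.fromBlocks_mem_extSet (hD : IsFreeSet D) {X : Matrix ι ι R} {Y : Matrix κ κ R}
    (hX : X ∈ extSet D ι) (hY : Y ∈ extSet D κ) :
    Matrix.fromBlocks X 0 0 Y ∈ extSet D (ι ⊕ κ) := by
  rw [hD.mem_extSet_iff
    (((Fintype.equivFin ι).sumCongr (Fintype.equivFin κ)).trans finSumFinEquiv)]
  convert hD.dirSum_mem _ _ _ hX _ hY using 1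
  ext i j
  obtain ⟨i, rfl⟩ := finSumFinEquiv.surjective i
  obtain ⟨j, rfl⟩ := finSumFinEquiv.surjective j
  rcases i with i | i <;> rcases j with j | j <;> simp [dirSum]

section Map

variable [AddCommGroup A] [Module ℂ A] {S : Submodule ℂ A} {u : GradedMap R A}

theorem IsRealFreeFunction.extMap_fin (hD : IsFreeSet D) (hu : IsRealFreeFunction D S u) {n : ℕ}
    {X : Matrix (Fin n) (Fin n) R} (hX : X ∈ D n) : extMap u (Fin n) X = u n X :=
  hu.extMap_eq (Equiv.refl _) (hD.mem_extSet_fin.2 hX)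

theorem IsRealFreeFunction.extMap_submatrix (hD : IsFreeSet D) (hu : IsRealFreeFunction D S u)
    (e : κ ≃ ι) {X : Matrix ι ι R} (hX : X ∈ extSet D ι) :
    extMap u κ (X.submatrix e e) = (extMap u ι X).submatrix e e := by
  rw [hu.extMap_eq (e.trans (Fintype.equivFin ι)) ((hD.submatrix_mem_extSet_iff e).2 hX)]
  have : (X.submatrix e e).submatrix (e.trans (Fintype.equivFin ι)).symm
      (e.trans (Fintype.equivFin ι)).symm
        = X.submatrix (Fintype.equivFin ι).symm (Fintype.equivFin ι).symm := by
    ext; simp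
  rw [this]
  ext; simp [extMap]

theorem IsRealFreeFunction.extMap_fromBlocks (hD : IsFreeSet D) (hu : IsRealFreeFunction D S u)
    {X : Matrix ι ι R} {Y : Matrix κ κ R} (hX : X ∈ extSet D ι) (hY : Y ∈ extSet D κ) :
    extMap u (ι ⊕ κ) (Matrix.fromBlocks X 0 0 Y)
      = Matrix.fromBlocks (extMap u ι X) 0 0 (extMap u κ Y) := by
  set e := ((Fintype.equivFin ι).sumCongr (Fintype.equivFin κ)).trans finSumFinEquiv with he
  rw [hu.extMap_eq e (hD.fromBlocks_mem_extSet hX hY)]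
  have : (Matrix.fromBlocks X 0 0 Y).submatrix e.symm e.symm
      = dirSum (X.submatrix (Fintype.equivFin ι).symm (Fintype.equivFin ι).symm)
        (Y.submatrix (Fintype.equivFin κ).symm (Fintype.equivFin κ).symm) := by
    ext i j
    obtain ⟨i, rfl⟩ := finSumFinEquiv.surjective i
    obtain ⟨j, rfl⟩ := finSumFinEquiv.surjective j
    rcases i with i | i <;> rcases j with j | j <;> simp [dirSum, he]
  rw [this, hu.map_dirSum _ _ _ hX _ hY]
  ext (i | i) (j | j) <;> simp [dirSum, he, extMap]

theorem IsRealFreeFunction.extMap_tripleProd [DecidableEq ι] (hu : IsRealFreeFunction D S u)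
    {X : Matrix ι ι R} (hX : X ∈ extSet D ι) {V : Matrix ι ι ℂ}
    (hV : V ∈ Matrix.unitaryGroup ι ℂ) :
    extMap u ι (tripleProd (star V) X V) = tripleProd (star V) (extMap u ι X) V := by
  set e := Fintype.equivFin ι
  have hV' : V.submatrix e.symm e.symm ∈ Matrix.unitaryGroup _ ℂ := by
    rw [Matrix.mem_unitaryGroup_iff'] at hV ⊢
    rw [Matrix.star_eq_conjTranspose, Matrix.conjTranspose_submatrix, Matrix.submatrix_mul_equiv,
      ← Matrix.star_eq_conjTranspose, hV, Matrix.submatrix_one_equiv]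
  have h1 : (tripleProd (star V) X V).submatrix e.symm e.symm
      = sandwich (star (V.submatrix e.symm e.symm)) (X.submatrix e.symm e.symm)
        (V.submatrix e.symm e.symm) := by
    rw [← tripleProd_submatrix _ _ _ _ e.symm e.symm]
    rfl
  change (u _ (Matrix.submatrix _ e.symm e.symm)).submatrix e e = _
  rw [h1, hu.map_unitary _ _ hX _ hV']
  have h2 : star V = (star (V.submatrix e.symm e.symm)).submatrix e e := by
    ext; simp
  have h3 : V = (V.submatrix e.symm e.symm).submatrix e e := by
    ext; simp
  refine (tripleProd_submatrix (star (V.submatrix e.symm e.symm)) _ (V.submatrix e.symm e.symm) e e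
    e e).symm.trans ?_
  rw [← h2, ← h3]
  rfl

theorem IsRealFreeFunction.extMap_entry_mem (hu : IsRealFreeFunction D S u) {X : Matrix ι ι R}
    (hX : X ∈ extSet D ι) (i j : ι) : extMap u ι X i j ∈ S :=
  hu.entry_mem _ _ hX _ _

end Map

section Pluriharmonic

variable [TopologicalSpace R] [NormedAddCommGroup A] [NormedSpace ℂ A] [Star A]
  {u : GradedMap R A}

theorem IsPluriharmonic.extMap_isHermitian (hu : IsPluriharmonic D u) {X : Matrix ι ι R}
    (hX : X ∈ extSet D ι) (i j : ι) : star (extMap u ι X i j) = extMap u ι X j i :=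
  (hu.isHermitian _ _ hX).apply _ _

theorem IsPluriharmonic.extMap_continuousOn (hu : IsPluriharmonic D u) :
    ContinuousOn (extMap u ι) (extSet D ι) := by
  have h1 : Continuous fun X : Matrix ι ι R =>
      X.submatrix (Fintype.equivFin ι).symm (Fintype.equivFin ι).symm := by fun_prop
  have h2 : Continuous fun X : Matrix (Fin (Fintype.card ι)) (Fin (Fintype.card ι)) A =>
      X.submatrix (Fintype.equivFin ι) (Fintype.equivFin ι) := by fun_prop
  exact h2.comp_continuousOn ((hu.continuousOn _).comp h1.continuousOn fun X hX => hX)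

theorem IsPluriharmonic.extMap_contDiffAt (hu : IsPluriharmonic D u) {X : Matrix ι ι R}
    (hX : X ∈ extSet D ι) (H K : Matrix ι ι R) (i j : ι) :
    ContDiffAt ℝ 2 (fun p : ℂ × ℂ => extMap u ι (X + p.1 • H + p.2 • K) i j) 0 :=
  hu.contDiffAt _ _ hX (H.submatrix _ _) (K.submatrix _ _) _ _

theorem IsPluriharmonic.extMap_laplacian (hu : IsPluriharmonic D u) {X : Matrix ι ι R}
    (hX : X ∈ extSet D ι) (H : Matrix ι ι R) (i j : ι) :
    Laplacian.laplacian (fun z : ℂ => extMap u ι (X + z • H) i j) 0 = 0 := by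
  have h := congrFun (congrFun (hu.complexHessian_eq_zero _ _ hX (H.submatrix
    (Fintype.equivFin ι).symm (Fintype.equivFin ι).symm)) (Fintype.equivFin ι i))
    (Fintype.equivFin ι j)
  simp only [complexHessian, Matrix.of_apply, Matrix.zero_apply] at h
  exact (smul_eq_zero.1 h).resolve_left (by norm_num)

end Pluriharmonic

end Extension

/-! ### Directional derivatives and their equivariance. -/

open Complex Metric

/-- The real directional derivative of a graded map. -/
noncomputable def dirDeriv {R A : Type*} [AddCommGroup R] [Module ℂ R] [NormedAddCommGroup A]
    [NormedSpace ℂ A] (u : GradedMap R A) {ι : Type} [Fintype ι] (X H : Matrix ι ι R) :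
    Matrix ι ι A :=
  Matrix.of fun i j => fderiv ℝ (fun z : ℂ => extMap u ι (X + z • H) i j) 0 1

/-- The upper right block of the derivative at `X ⊕ Y` in the direction of a strictly upper
triangular block matrix. -/
noncomputable def offDiag {R A : Type*} [AddCommGroup R] [Module ℂ R] [NormedAddCommGroup A]
    [NormedSpace ℂ A] (u : GradedMap R A) {ι κ : Type} [Fintype ι] [Fintype κ]
    (X : Matrix ι ι R) (Y : Matrix κ κ R) (B : Matrix ι κ R) : Matrix ι κ A :=
  (dirDeriv u (Matrix.fromBlocks X 0 0 Y) (Matrix.fromBlocks 0 B 0 0)).toBlocks₁₂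

section Derivative

variable {R A : Type*} [AddCommGroup R] [Module ℂ R] [TopologicalSpace R]
    [IsTopologicalAddGroup R] [ContinuousSMul ℂ R] [NonUnitalCStarAlgebra A]
    {S : Submodule ℂ A} {D : GradedSet R} {u : GradedMap R A}
    {ι κ : Type} [Fintype ι] [Fintype κ]

theorem eventually_add_smul_mem (hDo : IsOpenLevels D) {X : Matrix ι ι R} (H : Matrix ι ι R)
    {t : ℂ} (hX : X + t • H ∈ extSet D ι) : ∀ᶠ z : ℂ in 𝓝 t, X + z • H ∈ extSet D ι := by
  have hc : Continuous fun z : ℂ => X + z • H := by fun_prop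
  exact hc.continuousAt.preimage_mem_nhds ((isOpen_extSet hDo).mem_nhds hX)

/-- Smoothness is available on two-dimensional slices only; this chain rule turns it into real
linearity of the directional derivative on the complex span of `H` and `K`. -/
theorem IsPluriharmonic.dirDeriv_slice (hu : IsPluriharmonic D u) {X : Matrix ι ι R}
    (hX : X ∈ extSet D ι) (H K : Matrix ι ι R) (i j : ι) (a b : ℂ) :
    dirDeriv u X (a • H + b • K) i j
      = fderiv ℝ (fun p : ℂ × ℂ => extMap u ι (X + p.1 • H + p.2 • K) i j) 0 (a, b) := by
  have h1 := ((hu.extMap_contDiffAt hX H K i j).differentiableAt (by norm_num)).hasFDerivAt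
  have h2 : HasFDerivAt (fun z : ℂ => (z * a, z * b))
      (((ContinuousLinearMap.id ℝ ℂ).smulRight a).prod
        ((ContinuousLinearMap.id ℝ ℂ).smulRight b)) (0 : ℂ) :=
    (((hasFDerivAt_id (𝕜 := ℝ) (0 : ℂ)).smul_const a).prodMk
      ((hasFDerivAt_id (𝕜 := ℝ) (0 : ℂ)).smul_const b))
  have h0 : ((0 : ℂ) * a, (0 : ℂ) * b) = 0 := by simp
  rw [← h0] at h1
  have h3 := (HasFDerivAt.comp (f := fun z : ℂ => (z * a, z * b)) (0 : ℂ) h1 h2).fderiv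
  have h4 : ((fun p : ℂ × ℂ => extMap u ι (X + p.1 • H + p.2 • K) i j) ∘
      fun z : ℂ => (z * a, z * b)) = fun z : ℂ => extMap u ι (X + z • (a • H + b • K)) i j := by
    funext z
    simp [smul_add, smul_smul, add_assoc]
  rw [h4] at h3
  simp only [dirDeriv, Matrix.of_apply, h3, h0]
  simp

theorem IsPluriharmonic.dirDeriv_add (hu : IsPluriharmonic D u) {X : Matrix ι ι R}
    (hX : X ∈ extSet D ι) (H K : Matrix ι ι R) :
    dirDeriv u X (H + K) = dirDeriv u X H + dirDeriv u X K := by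
  ext i j
  have h1 := hu.dirDeriv_slice hX H K i j 1 1
  have h2 := hu.dirDeriv_slice hX H K i j 1 0
  have h3 := hu.dirDeriv_slice hX H K i j 0 1
  simp only [one_smul, zero_smul, add_zero, zero_add] at h1 h2 h3
  rw [Matrix.add_apply, h1, h2, h3, ← map_add]
  simp

theorem IsPluriharmonic.dirDeriv_real_smul (hu : IsPluriharmonic D u) {X : Matrix ι ι R}
    (hX : X ∈ extSet D ι) (H : Matrix ι ι R) (r : ℝ) :
    dirDeriv u X ((r : ℂ) • H) = (r : ℂ) • dirDeriv u X H := by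
  ext i j
  have h1 := hu.dirDeriv_slice hX H 0 i j r 0
  have h2 := hu.dirDeriv_slice hX H 0 i j 1 0
  simp only [one_smul, zero_smul, add_zero] at h1 h2
  rw [Matrix.smul_apply, h1, h2, Complex.coe_smul, ← map_smul]
  simp

theorem IsPluriharmonic.dirDeriv_neg (hu : IsPluriharmonic D u) {X : Matrix ι ι R}
    (hX : X ∈ extSet D ι) (H : Matrix ι ι R) : dirDeriv u X (-H) = -dirDeriv u X H := by
  simpa using hu.dirDeriv_real_smul hX H (-1)

theorem IsPluriharmonic.differentiableAt_slice (hu : IsPluriharmonic D u) {X : Matrix ι ι R}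
    (hX : X ∈ extSet D ι) (H : Matrix ι ι R) (i j : ι) :
    DifferentiableAt ℝ (fun z : ℂ => extMap u ι (X + z • H) i j) 0 := by
  have h1 := (hu.extMap_contDiffAt hX H 0 i j).differentiableAt (by norm_num)
  have h2 : DifferentiableAt ℝ (fun z : ℂ => (z, (0 : ℂ))) 0 := by fun_prop
  simpa [Function.comp_def] using DifferentiableAt.comp (f := fun z : ℂ => (z, (0 : ℂ))) 0 h1 h2

theorem dirDeriv_tripleProd [DecidableEq ι] (hDo : IsOpenLevels D)
    (hf : IsRealFreeFunction D S u) (hu : IsPluriharmonic D u) {X : Matrix ι ι R}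
    (hX : X ∈ extSet D ι) (H : Matrix ι ι R) {V : Matrix ι ι ℂ}
    (hV : V ∈ Matrix.unitaryGroup ι ℂ) :
    dirDeriv u (tripleProd (star V) X V) (tripleProd (star V) H V)
      = tripleProd (star V) (dirDeriv u X H) V := by
  ext i j
  have h1 : (fun z : ℂ => extMap u ι (tripleProd (star V) X V + z • tripleProd (star V) H V) i j)
      =ᶠ[𝓝 0] fun z => ∑ k, ∑ l, (star V i k * V l j) • extMap u ι (X + z • H) k l := by
    filter_upwards [eventually_add_smul_mem hDo H (t := 0) (by simpa using hX)] with z hz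
    rw [← tripleProd_smul, ← tripleProd_add, hf.extMap_tripleProd hz hV]
    rfl
  simp only [dirDeriv, Matrix.of_apply, h1.fderiv_eq]
  have h2 : HasFDerivAt (fun z => ∑ k, ∑ l, (star V i k * V l j) • extMap u ι (X + z • H) k l)
      (∑ k, ∑ l, (star V i k * V l j) • fderiv ℝ (fun z : ℂ => extMap u ι (X + z • H) k l) 0) 0 :=
    HasFDerivAt.fun_sum fun k _ => HasFDerivAt.fun_sum fun l _ =>
      (hu.differentiableAt_slice hX H k l).hasFDerivAt.const_smul _
  rw [h2.fderiv]
  simp [tripleProd_apply]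

theorem dirDeriv_submatrix (hD : IsFreeSet D) (hDo : IsOpenLevels D)
    (hf : IsRealFreeFunction D S u) {X : Matrix ι ι R} (hX : X ∈ extSet D ι) (H : Matrix ι ι R)
    (e : κ ≃ ι) :
    dirDeriv u (X.submatrix e e) (H.submatrix e e) = (dirDeriv u X H).submatrix e e := by
  ext i j
  have h1 : (fun z : ℂ => extMap u κ (X.submatrix e e + z • H.submatrix e e) i j)
      =ᶠ[𝓝 0] fun z => extMap u ι (X + z • H) (e i) (e j) := by
    filter_upwards [eventually_add_smul_mem hDo H (t := 0) (by simpa using hX)] with z hz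
    change extMap u κ ((X + z • H).submatrix e e) i j = _
    rw [hf.extMap_submatrix hD e hz]
    rfl
  simp only [dirDeriv, Matrix.of_apply, h1.fderiv_eq, Matrix.submatrix_apply]

theorem dirDeriv_fromBlocks (hD : IsFreeSet D) (hDo : IsOpenLevels D)
    (hf : IsRealFreeFunction D S u) {X : Matrix ι ι R} (hX : X ∈ extSet D ι) (H : Matrix ι ι R)
    {Y : Matrix κ κ R} (hY : Y ∈ extSet D κ) :
    dirDeriv u (Matrix.fromBlocks X 0 0 Y) (Matrix.fromBlocks H 0 0 0)
      = Matrix.fromBlocks (dirDeriv u X H) 0 0 0 := by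
  have h1 : ∀ i j, (fun z : ℂ => extMap u (ι ⊕ κ)
      (Matrix.fromBlocks X 0 0 Y + z • Matrix.fromBlocks H 0 0 0) i j)
      =ᶠ[𝓝 0] fun z => Matrix.fromBlocks (extMap u ι (X + z • H)) 0 0 (extMap u κ Y) i j := by
    intro i j
    filter_upwards [eventually_add_smul_mem hDo H (t := 0) (by simpa using hX)] with z hz
    rw [← hf.extMap_fromBlocks hD hz hY, Matrix.fromBlocks_smul, Matrix.fromBlocks_add]
    simp
  ext (i | i) (j | j) <;> simp [dirDeriv, (h1 _ _).fderiv_eq]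

theorem IsPluriharmonic.star_dirDeriv (hDo : IsOpenLevels D) (hu : IsPluriharmonic D u)
    {X : Matrix ι ι R} (hX : X ∈ extSet D ι) (H : Matrix ι ι R) (i j : ι) :
    star (dirDeriv u X H i j) = dirDeriv u X H j i := by
  have h1 : (fun z : ℂ => extMap u ι (X + z • H) j i)
      =ᶠ[𝓝 0] fun z => star (extMap u ι (X + z • H) i j) := by
    filter_upwards [eventually_add_smul_mem hDo H (t := 0) (by simpa using hX)] with z hz
    rw [hu.extMap_isHermitian hz]
  simp only [dirDeriv, Matrix.of_apply, h1.fderiv_eq]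
  rw [(hu.differentiableAt_slice hX H i j).hasFDerivAt.star.fderiv]
  simp

/-- The hypotheses on `u` speak of the centre of a slice; moving the base point along the line
carries them to every parameter `t`, even when `X` itself lies outside the domain. -/
theorem IsPluriharmonic.harmonic_slice (hu : IsPluriharmonic D u) {X : Matrix ι ι R}
    (H : Matrix ι ι R) {t : ℂ} (hX : X + t • H ∈ extSet D ι) (i j : ι) :
    ContDiffAt ℝ 2 (fun z : ℂ => extMap u ι (X + z • H) i j) t ∧
      Laplacian.laplacian (fun z : ℂ => extMap u ι (X + z • H) i j) t = 0 := by
  have e : ∀ z : ℂ, X + t • H + z • H = X + (t + z) • H := fun z => by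
    rw [add_smul, add_assoc]
  constructor
  · have h1 := hu.extMap_contDiffAt hX H 0 i j
    have h2 : ContDiffAt ℝ 2 (fun z : ℂ => (z - t, (0 : ℂ))) t := by fun_prop
    have h3 : ((t - t, (0 : ℂ)) : ℂ × ℂ) = 0 := by simp
    rw [← h3] at h1
    simpa [Function.comp_def, e] using ContDiffAt.comp (f := fun z : ℂ => (z - t, (0 : ℂ))) t h1 h2
  · have h1 := hu.extMap_laplacian hX H i j
    simp only [e] at h1
    rw [InnerProductSpace.laplacian_eq_iteratedFDeriv_complexPlane] at h1 ⊢
    simpa [iteratedFDeriv_comp_add_left 2 t (f := fun z : ℂ => extMap u ι (X + z • H) i j)] using h1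

end Derivative

/-! ### The upper right block at block triangular matrices. -/

section OffDiagonal

variable {R A : Type*} [AddCommGroup R] [Module ℂ R] [TopologicalSpace R]
    [IsTopologicalAddGroup R] [ContinuousSMul ℂ R] [NonUnitalCStarAlgebra A]
    {S : Submodule ℂ A} {D : GradedSet R} {u : GradedMap R A}
    {ι κ : Type} [Fintype ι] [Fintype κ]

theorem fromBlocks_unitary [DecidableEq ι] [DecidableEq κ] {U : Matrix ι ι ℂ} {V : Matrix κ κ ℂ}
    (hU : U ∈ Matrix.unitaryGroup ι ℂ) (hV : V ∈ Matrix.unitaryGroup κ ℂ) :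
    Matrix.fromBlocks U 0 0 V ∈ Matrix.unitaryGroup (ι ⊕ κ) ℂ := by
  rw [Matrix.mem_unitaryGroup_iff'] at *
  rw [Matrix.star_eq_conjTranspose] at *
  rw [Matrix.fromBlocks_conjTranspose, Matrix.fromBlocks_multiply]
  simp [hU, hV]

theorem tripleProd_star_fromBlocks {R : Type*} [AddCommGroup R] [Module ℂ R] (U : Matrix ι ι ℂ)
    (V : Matrix κ κ ℂ) (X : Matrix ι ι R) (B : Matrix ι κ R) (C : Matrix κ ι R)
    (Y : Matrix κ κ R) :
    tripleProd (star (Matrix.fromBlocks U 0 0 V)) (Matrix.fromBlocks X B C Y)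
      (Matrix.fromBlocks U 0 0 V) = Matrix.fromBlocks (tripleProd (star U) X U)
        (tripleProd (star U) B V) (tripleProd (star V) C U) (tripleProd (star V) Y V) := by
  rw [← tripleProd_fromBlocks]
  simp [Matrix.star_eq_conjTranspose, Matrix.fromBlocks_conjTranspose]

/-- Conjugation by `1 ⊕ w` fixes both diagonal blocks and multiplies the corner by `w`, so the
corner entry of `u` is a rotation equivariant harmonic function of `t`, hence linear. Its slope is
identified by differentiating at `0`. -/
theorem extMap_fromBlocks_upper (hf : IsRealFreeFunction D S u)
    (hu : IsPluriharmonic D u) {X : Matrix ι ι R} {Y : Matrix κ κ R} {B : Matrix ι κ R} {r : ℝ}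
    (hr : ∀ t ∈ ball (0 : ℂ) r, Matrix.fromBlocks X (t • B) 0 Y ∈ extSet D (ι ⊕ κ))
    (k : ι) (o : κ) {t : ℂ} (ht : t ∈ ball (0 : ℂ) r) :
    extMap u (ι ⊕ κ) (Matrix.fromBlocks X (t • B) 0 Y) (Sum.inl k) (Sum.inr o)
      = t • offDiag u X Y B k o := by
  classical
  have e : ∀ t : ℂ, Matrix.fromBlocks X (t • B) 0 Y
      = Matrix.fromBlocks X 0 0 Y + t • Matrix.fromBlocks 0 B 0 0 := fun t => by
    simp [Matrix.fromBlocks_smul, Matrix.fromBlocks_add]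
  simp only [e] at hr ⊢
  set φ : ℂ → A := fun t => extMap u (ι ⊕ κ)
    (Matrix.fromBlocks X 0 0 Y + t • Matrix.fromBlocks 0 B 0 0) (Sum.inl k) (Sum.inr o) with hφ
  obtain ⟨c, hc⟩ := exists_eq_smul_of_rotation_equivariant (φ := φ) (r := r) (fun t ht =>
    ⟨(hu.harmonic_slice _ (hr t ht) _ _).1, by
      filter_upwards [isOpen_ball.mem_nhds ht] with s hs
      exact (hu.harmonic_slice _ (hr s hs) _ _).2⟩) (fun w t hw ht => by
    have hV : (Matrix.fromBlocks 1 0 0 (w • 1) : Matrix (ι ⊕ κ) (ι ⊕ κ) ℂ) ∈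
        Matrix.unitaryGroup (ι ⊕ κ) ℂ := by
      refine fromBlocks_unitary (one_mem _) ?_
      rw [Matrix.mem_unitaryGroup_iff', star_smul, star_one, smul_mul_smul_comm, mul_one]
      have : star w * w = 1 := by
        rw [Complex.star_def, ← normSq_eq_conj_mul_self, normSq_eq_norm_sq, hw]; norm_num
      rw [this, one_smul]
    have h1 := hf.extMap_tripleProd (hr t ht) hV
    simp only [← e] at h1
    rw [tripleProd_star_fromBlocks] at h1
    simp only [star_one, tripleProd_one_one, tripleProd_smul_right, tripleProd_zero_mid] at h1
    have h2 := congrFun (congrFun h1 (Sum.inl k)) (Sum.inr o)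
    rw [← Matrix.fromBlocks_toBlocks (extMap u (ι ⊕ κ) (Matrix.fromBlocks X (t • B) 0 Y)),
      tripleProd_star_fromBlocks] at h2
    simp only [star_one, tripleProd_one_one, tripleProd_smul_right, Matrix.fromBlocks_apply₁₂] at h2
    have h3 : tripleProd (star (w • (1 : Matrix κ κ ℂ))) Y 1 = (star w) • Y := by
      rw [star_smul, star_one, tripleProd_smul_left, tripleProd_one_one]
    have h4 : star w * w = 1 := by
      rw [Complex.star_def, ← normSq_eq_conj_mul_self, normSq_eq_norm_sq, hw]; norm_num
    rw [h3, smul_smul w (star w) Y, mul_comm w, h4, one_smul, smul_smul w t] at h2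
    simpa [hφ, ← e, Matrix.toBlocks₁₂] using h2)
  have hr0 : 0 < r := lt_of_le_of_lt (norm_nonneg t) (by simpa using ht)
  have h1 : offDiag u X Y B k o = c := by
    have h2 : φ =ᶠ[𝓝 0] fun t => t • c := by
      filter_upwards [ball_mem_nhds (0 : ℂ) hr0] with t ht using hc t ht
    change fderiv ℝ φ 0 1 = c
    have h3 : HasFDerivAt (fun t : ℂ => t • c)
        ((ContinuousLinearMap.id ℝ ℂ).smulRight c) (0 : ℂ) :=
      (hasFDerivAt_id (𝕜 := ℝ) (0 : ℂ)).smul_const c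
    rw [h2.fderiv_eq, h3.fderiv]
    simp
  rw [h1]
  exact hc t ht

theorem exists_ball_fromBlocks_mem (hD : IsFreeSet D) (hDo : IsOpenLevels D) {X : Matrix ι ι R}
    {Y : Matrix κ κ R} (hX : X ∈ extSet D ι) (hY : Y ∈ extSet D κ) (B : Matrix ι κ R) :
    ∃ r > 0, ∀ t ∈ ball (0 : ℂ) r, Matrix.fromBlocks X (t • B) 0 Y ∈ extSet D (ι ⊕ κ) := by
  have hc : Continuous fun t : ℂ => Matrix.fromBlocks X (t • B) 0 Y := by fun_prop
  have := hc.continuousAt.preimage_mem_nhds ((isOpen_extSet hDo).mem_nhds (x := _) (by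
    simpa using hD.fromBlocks_mem_extSet hX hY : Matrix.fromBlocks X ((0 : ℂ) • B) 0 Y ∈ _))
  obtain ⟨r, hr, h⟩ := Metric.mem_nhds_iff.1 this
  exact ⟨r, hr, fun t ht => h ht⟩

theorem offDiag_add (hD : IsFreeSet D) (hu : IsPluriharmonic D u) {X : Matrix ι ι R}
    {Y : Matrix κ κ R} (hX : X ∈ extSet D ι) (hY : Y ∈ extSet D κ) (B C : Matrix ι κ R) :
    offDiag u X Y (B + C) = offDiag u X Y B + offDiag u X Y C := by
  have : (Matrix.fromBlocks 0 (B + C) 0 0 : Matrix (ι ⊕ κ) (ι ⊕ κ) R)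
      = Matrix.fromBlocks 0 B 0 0 + Matrix.fromBlocks 0 C 0 0 := by
    simp [Matrix.fromBlocks_add]
  rw [offDiag, this, hu.dirDeriv_add (hD.fromBlocks_mem_extSet hX hY)]
  rfl

/-- The derivative is a priori only real linear. Complex homogeneity follows by reading the matrix
with corner `t z B` in two ways, for one small `t ≠ 0`. -/
theorem offDiag_smul (hD : IsFreeSet D) (hDo : IsOpenLevels D) (hf : IsRealFreeFunction D S u)
    (hu : IsPluriharmonic D u) {X : Matrix ι ι R} {Y : Matrix κ κ R} (hX : X ∈ extSet D ι)
    (hY : Y ∈ extSet D κ) (z : ℂ) (B : Matrix ι κ R) :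
    offDiag u X Y (z • B) = z • offDiag u X Y B := by
  ext k o
  obtain ⟨r, hr, h⟩ := exists_ball_fromBlocks_mem hD hDo hX hY B
  obtain ⟨r', hr', h'⟩ := exists_ball_fromBlocks_mem hD hDo hX hY (z • B)
  have e1 : ∀ᶠ t : ℂ in 𝓝 0, t ∈ ball (0 : ℂ) r' := ball_mem_nhds _ hr'
  have e2 : ∀ᶠ t : ℂ in 𝓝 0, t * z ∈ ball (0 : ℂ) r := by
    have hc : Continuous fun t : ℂ => t * z := by fun_prop
    exact hc.continuousAt.preimage_mem_nhds (by simpa using ball_mem_nhds (0 : ℂ) hr)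
  obtain ⟨t, ⟨h1, h2⟩, h3⟩ := ((e1.and e2).filter_mono nhdsWithin_le_nhds |>.and
    (self_mem_nhdsWithin : ∀ᶠ t : ℂ in 𝓝[≠] 0, t ∈ ({0}ᶜ : Set ℂ))).exists
  have a1 := extMap_fromBlocks_upper hf hu h' k o h1
  have a2 := extMap_fromBlocks_upper hf hu h k o h2
  rw [smul_smul, a2, mul_smul] at a1
  exact (smul_right_injective A h3 a1).symm

/-- With `s` as the coefficient of the corner `B`, the corner entry of `u` is `s c(z)`.
Pluriharmonicity in the direction `K ⊕ L`, and in the same direction with `B` added in the corner,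
supplies the two equations of `differentiableAt_of_laplacian_smul_eq_zero`. -/
theorem offDiag_analyticAt (hD : IsFreeSet D) (hDo : IsOpenLevels D)
    (hf : IsRealFreeFunction D S u) (hu : IsPluriharmonic D u) {X : Matrix ι ι R}
    {Y : Matrix κ κ R} (hX : X ∈ extSet D ι) (hY : Y ∈ extSet D κ) (K : Matrix ι ι R)
    (L : Matrix κ κ R) (B : Matrix ι κ R) (k : ι) (o : κ) :
    AnalyticAt ℂ (fun z : ℂ => offDiag u (X + z • K) (Y + z • L) B k o) 0 := by
  have hc : Continuous fun p : ℂ × ℂ =>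
      Matrix.fromBlocks (X + p.1 • K) (p.2 • B) 0 (Y + p.1 • L) := by fun_prop
  have hnhds := hc.continuousAt.preimage_mem_nhds ((isOpen_extSet hDo).mem_nhds (x := _) (by
    simpa using hD.fromBlocks_mem_extSet hX hY :
      Matrix.fromBlocks (X + (0 : ℂ × ℂ).1 • K) ((0 : ℂ × ℂ).2 • B) 0 (Y + (0 : ℂ × ℂ).1 • L)
        ∈ extSet D (ι ⊕ κ)))
  obtain ⟨ε, hε, h⟩ := Metric.mem_nhds_iff.1 hnhds
  have hmem : ∀ z ∈ ball (0 : ℂ) ε, ∀ s ∈ ball (0 : ℂ) ε,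
      Matrix.fromBlocks (X + z • K) (s • B) 0 (Y + z • L) ∈ extSet D (ι ⊕ κ) := by
    intro z hz s hs
    refine h (show (z, s) ∈ ball (0 : ℂ × ℂ) ε from ?_)
    have := Set.mk_mem_prod hz hs
    rwa [ball_prod_same] at this
  set c : ℂ → A := fun z => offDiag u (X + z • K) (Y + z • L) B k o with hcdef
  have hψ : ∀ z ∈ ball (0 : ℂ) ε, ∀ s ∈ ball (0 : ℂ) ε, extMap u (ι ⊕ κ)
      (Matrix.fromBlocks (X + z • K) (s • B) 0 (Y + z • L)) (Sum.inl k) (Sum.inr o) = s • c z :=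
    fun z hz s hs => extMap_fromBlocks_upper hf hu (hmem z hz) k o hs
  set s₀ : ℂ := ((ε / 2 : ℝ) : ℂ)
  have hs₀ : s₀ ∈ ball (0 : ℂ) ε := by
    simp only [s₀, mem_ball_zero_iff, Complex.norm_real, Real.norm_eq_abs]
    rw [abs_of_pos] <;> linarith
  have hs₀0 : s₀ ≠ 0 := by
    simp only [s₀, ne_eq, ofReal_eq_zero]
    positivity
  refine DifferentiableOn.analyticAt (s := ball 0 ε) (fun x hx => ?_) (ball_mem_nhds _ hε)
  refine DifferentiableAt.differentiableWithinAt ?_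
  have e1 : ∀ z : ℂ, Matrix.fromBlocks (X + z • K) (s₀ • B) 0 (Y + z • L)
      = Matrix.fromBlocks X (s₀ • B) 0 Y + z • Matrix.fromBlocks K 0 0 L := fun z => by
    simp [Matrix.fromBlocks_smul, Matrix.fromBlocks_add]
  -- The line is placed so that it meets `s = s₀` exactly at `z = x`.
  have e2 : ∀ z : ℂ, Matrix.fromBlocks (X + z • K) ((s₀ + (z - x)) • B) 0 (Y + z • L)
      = Matrix.fromBlocks X ((s₀ - x) • B) 0 Y + z • Matrix.fromBlocks K B 0 L := fun z => by
    simp only [Matrix.fromBlocks_smul, Matrix.fromBlocks_add, smul_zero, add_zero, ← add_smul]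
    congr 2
    ring
  have h1 := hu.harmonic_slice (X := Matrix.fromBlocks X (s₀ • B) 0 Y)
    (Matrix.fromBlocks K 0 0 L) (t := x) (by rw [← e1]; exact hmem x hx s₀ hs₀)
    (Sum.inl k) (Sum.inr o)
  have h2 := hu.harmonic_slice (X := Matrix.fromBlocks X ((s₀ - x) • B) 0 Y)
    (Matrix.fromBlocks K B 0 L) (t := x) (by rw [← e2]; simpa using hmem x hx s₀ hs₀)
    (Sum.inl k) (Sum.inr o)
  simp only [← e1] at h1
  simp only [← e2] at h2
  have c1 : c =ᶠ[𝓝 x] s₀⁻¹ • fun z => extMap u (ι ⊕ κ)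
      (Matrix.fromBlocks (X + z • K) (s₀ • B) 0 (Y + z • L)) (Sum.inl k) (Sum.inr o) := by
    filter_upwards [isOpen_ball.mem_nhds hx] with z hz
    rw [Pi.smul_apply, hψ z hz s₀ hs₀, smul_smul, inv_mul_cancel₀ hs₀0, one_smul]
  have c2 : (fun z => (s₀ + (z - x)) • c z) =ᶠ[𝓝 x] fun z => extMap u (ι ⊕ κ)
      (Matrix.fromBlocks (X + z • K) ((s₀ + (z - x)) • B) 0 (Y + z • L))
        (Sum.inl k) (Sum.inr o) := by
    have hcont : Continuous fun z : ℂ => s₀ + (z - x) := by fun_prop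
    have := hcont.continuousAt (x := x) |>.preimage_mem_nhds
      (isOpen_ball.mem_nhds (show s₀ + (x - x) ∈ ball (0 : ℂ) ε by simpa using hs₀))
    filter_upwards [isOpen_ball.mem_nhds hx, this] with z hz hz'
    rw [hψ z hz _ hz']
  refine differentiableAt_of_laplacian_smul_eq_zero (s := s₀)
    ((h1.1.const_smul s₀⁻¹).congr_of_eventuallyEq c1) ?_ ?_
  · rw [(InnerProductSpace.laplacian_congr_nhds c1).self_of_nhds,
      InnerProductSpace.laplacian_smul _ h1.1, h1.2, smul_zero]
  · rw [(InnerProductSpace.laplacian_congr_nhds c2).self_of_nhds, h2.2]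

end OffDiagonal

/-! ### Differences `XT - TY` and the values of `u` they determine. -/

/-- The difference `X T - T Y` for a scalar matrix `T`. -/
def twist {R ι κ : Type*} [AddCommGroup R] [Module ℂ R] [Fintype ι] [Fintype κ] [DecidableEq ι]
    [DecidableEq κ] (X : Matrix ι ι R) (T : Matrix ι κ ℂ) (Y : Matrix κ κ R) : Matrix ι κ R :=
  tripleProd 1 X T - tripleProd T Y 1

section Intertwine

variable {R A : Type*} [AddCommGroup R] [Module ℂ R] [TopologicalSpace R]
    [IsTopologicalAddGroup R] [ContinuousSMul ℂ R] [NonUnitalCStarAlgebra A]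
    {S : Submodule ℂ A} {D : GradedSet R} {u : GradedMap R A}
    {ι κ ν : Type} [Fintype ι] [Fintype κ] [Fintype ν] [DecidableEq ι] [DecidableEq κ]
    [DecidableEq ν]

theorem twist_smul_self_eq {R : Type*} [AddCommGroup R] [Module ℂ R] (X : Matrix ι ι R)
    (P : Matrix ι ι ℂ) (z : ℂ) :
    twist X (z • P) X = z • (tripleProd 1 X P - tripleProd P X P)
        + (-z) • (tripleProd P X 1 - tripleProd P X P) := by
  simp only [twist, tripleProd_smul_left, tripleProd_smul_right]
  module

theorem twist_add_mid (X : Matrix ι ι R) (T T' : Matrix ι κ ℂ) (Y : Matrix κ κ R) :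
    twist X (T + T') Y = twist X T Y + twist X T' Y := by
  simp only [twist, tripleProd_add_left, tripleProd_add_right]
  abel

theorem twist_smul_mid (z : ℂ) (X : Matrix ι ι R) (T : Matrix ι κ ℂ) (Y : Matrix κ κ R) :
    twist X (z • T) Y = z • twist X T Y := by
  simp only [twist, tripleProd_smul_left, tripleProd_smul_right, smul_sub]

theorem twist_add_smul (X K : Matrix ι ι R) (T : Matrix ι κ ℂ) (Y L : Matrix κ κ R) (z : ℂ) :
    twist (X + z • K) T (Y + z • L) = twist X T Y + z • twist K T L := by
  simp only [twist, tripleProd_add, tripleProd_smul, smul_sub]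
  abel

theorem twist_sub_mid (X : Matrix ι ι R) (T T' : Matrix ι κ ℂ) (Y : Matrix κ κ R) :
    twist X (T - T') Y = twist X T Y - twist X T' Y := by
  rw [sub_eq_add_neg, twist_add_mid, ← neg_one_smul ℂ T', twist_smul_mid]
  module

theorem twist_fromBlocks {R : Type*} [AddCommGroup R] [Module ℂ R] (X : Matrix ι ι R)
    (Y : Matrix κ κ R) (T : Matrix ι κ ℂ) (T' : Matrix κ ι ℂ) :
    twist (Matrix.fromBlocks X 0 0 Y) (Matrix.fromBlocks 0 T T' 0) (Matrix.fromBlocks X 0 0 Y)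
      = Matrix.fromBlocks 0 (twist X T Y) (twist Y T' X) 0 := by
  ext (i | i) (j | j) <;> simp [twist, tripleProd_one_left, tripleProd_one_right]

theorem continuous_twist (T : Matrix ι κ ℂ) (Y : Matrix κ κ R) :
    Continuous fun X : Matrix ι ι R => twist X T Y := by
  unfold twist tripleProd
  fun_prop

variable (u) in
/-- The value that plays the role of `f(X) T - T f(Y)` for the analytic completion `f`. -/
noncomputable def intertwine (X : Matrix ι ι R) (T : Matrix ι κ ℂ) (Y : Matrix κ κ R) :
    Matrix ι κ A :=
  offDiag u X Y (twist X T Y)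

/-- The slope is a scalar multiple of an entry of `u`, and its adjoint is a multiple of the
transposed entry. Both memberships are needed because `S` need not be closed under the involution.
-/
theorem offDiag_mem_of_forall (hD : IsFreeSet D) (hDo : IsOpenLevels D)
    (hf : IsRealFreeFunction D S u) (hu : IsPluriharmonic D u) {X : Matrix ι ι R}
    {Y : Matrix κ κ R} (hX : X ∈ extSet D ι) (hY : Y ∈ extSet D κ) (B : Matrix ι κ R)
    (k : ι) (o : κ) : offDiag u X Y B k o ∈ S ∧ star (offDiag u X Y B k o) ∈ S := by
  obtain ⟨r, hr, h⟩ := exists_ball_fromBlocks_mem hD hDo hX hY B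
  set t : ℂ := ((r / 2 : ℝ) : ℂ)
  have ht : t ∈ ball (0 : ℂ) r := by
    simp only [t, mem_ball_zero_iff, Complex.norm_real, Real.norm_eq_abs]
    rw [abs_of_pos] <;> linarith
  have ht0 : t ≠ 0 := by
    simp only [t, ne_eq, ofReal_eq_zero]
    positivity
  have h1 := extMap_fromBlocks_upper hf hu h k o ht
  have h2 : offDiag u X Y B k o = t⁻¹ • extMap u (ι ⊕ κ) (Matrix.fromBlocks X (t • B) 0 Y)
      (Sum.inl k) (Sum.inr o) := by
    rw [h1, smul_smul, inv_mul_cancel₀ ht0, one_smul]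
  rw [h2, star_smul, hu.extMap_isHermitian (h t ht)]
  exact ⟨S.smul_mem _ (hf.extMap_entry_mem (h t ht) _ _),
    S.smul_mem _ (hf.extMap_entry_mem (h t ht) _ _)⟩

theorem intertwine_continuousOn (hD : IsFreeSet D) (hDo : IsOpenLevels D)
    (hf : IsRealFreeFunction D S u) (hu : IsPluriharmonic D u) (T : Matrix ι κ ℂ)
    {Y : Matrix κ κ R} (hY : Y ∈ extSet D κ) (k : ι) (o : κ) :
    ContinuousOn (fun X => intertwine u X T Y k o) (extSet D ι) := by
  intro X hX
  refine ContinuousAt.continuousWithinAt ?_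
  have hct := continuous_twist (ι := ι) T Y
  have hc : Continuous fun p : Matrix ι ι R × ℂ =>
      Matrix.fromBlocks p.1 (p.2 • twist p.1 T Y) 0 Y := by fun_prop
  have hnhds : ∀ᶠ p : Matrix ι ι R × ℂ in 𝓝 X ×ˢ 𝓝 (0 : ℂ),
      Matrix.fromBlocks p.1 (p.2 • twist p.1 T Y) 0 Y ∈ extSet D (ι ⊕ κ) := by
    rw [← nhds_prod_eq]
    refine hc.continuousAt.preimage_mem_nhds ((isOpen_extSet hDo).mem_nhds ?_)
    simpa using hD.fromBlocks_mem_extSet hX hY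
  -- A product neighbourhood gives one disc of corner parameters valid for all points near `X`, so a
  -- single `t` recovers the slope from the continuous function `u` throughout.
  obtain ⟨P, hP, Q, hQ, hPQ⟩ := Filter.eventually_prod_iff.1 hnhds
  obtain ⟨r, hr, hrQ⟩ := Metric.mem_nhds_iff.1 hQ
  set t : ℂ := ((r / 2 : ℝ) : ℂ)
  have ht : t ∈ ball (0 : ℂ) r := by
    simp only [t, mem_ball_zero_iff, Complex.norm_real, Real.norm_eq_abs]
    rw [abs_of_pos] <;> linarith
  have ht0 : t ≠ 0 := by
    simp only [t, ne_eq, ofReal_eq_zero]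
    positivity
  have h1 : (fun X => intertwine u X T Y k o) =ᶠ[𝓝 X] fun X => t⁻¹ • extMap u (ι ⊕ κ)
      (Matrix.fromBlocks X (t • twist X T Y) 0 Y) (Sum.inl k) (Sum.inr o) := by
    filter_upwards [hP] with X' hX'
    rw [extMap_fromBlocks_upper hf hu (fun s hs => hPQ hX' (hrQ hs)) k o ht, smul_smul,
      inv_mul_cancel₀ ht0, one_smul]
    rfl
  refine ContinuousAt.congr ?_ h1.symm
  refine ContinuousAt.const_smul ?_ _
  have h2 : ContinuousAt (fun X' : Matrix ι ι R => extMap u (ι ⊕ κ)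
      (Matrix.fromBlocks X' (t • twist X' T Y) 0 Y)) X := by
    have h3 := (hu.extMap_continuousOn (ι := ι ⊕ κ)).continuousAt
      ((isOpen_extSet hDo).mem_nhds (hPQ hP.self_of_nhds (hrQ ht)))
    have h4 : Continuous fun X' : Matrix ι ι R => Matrix.fromBlocks X' (t • twist X' T Y) 0 Y := by
      fun_prop
    exact ContinuousAt.comp (f := fun X' : Matrix ι ι R =>
      Matrix.fromBlocks X' (t • twist X' T Y) 0 Y) h3 h4.continuousAt
  exact (continuous_apply_apply (ρ := fun _ _ => A) (Sum.inl k) (Sum.inr o)).continuousAt.comp h2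

theorem intertwine_analyticAt (hD : IsFreeSet D) (hDo : IsOpenLevels D)
    (hf : IsRealFreeFunction D S u) (hu : IsPluriharmonic D u) {X : Matrix ι ι R}
    {Y : Matrix κ κ R} (hX : X ∈ extSet D ι) (hY : Y ∈ extSet D κ) (K : Matrix ι ι R)
    (L : Matrix κ κ R) (T : Matrix ι κ ℂ) (k : ι) (o : κ) :
    AnalyticAt ℂ (fun z : ℂ => intertwine u (X + z • K) T (Y + z • L) k o) 0 := by
  have h1 : (fun z : ℂ => intertwine u (X + z • K) T (Y + z • L) k o) =ᶠ[𝓝 0] fun z =>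
      offDiag u (X + z • K) (Y + z • L) (twist X T Y) k o
        + z • offDiag u (X + z • K) (Y + z • L) (twist K T L) k o := by
    filter_upwards [eventually_add_smul_mem hDo K (t := 0) (by simpa using hX),
      eventually_add_smul_mem hDo L (t := 0) (by simpa using hY)] with z hz hz'
    rw [intertwine, twist_add_smul, offDiag_add hD hu hz hz', offDiag_smul hD hDo hf hu hz hz']
    rfl
  refine AnalyticAt.congr ?_ h1.symm
  exact (offDiag_analyticAt hD hDo hf hu hX hY K L _ k o).add
    (analyticAt_id.smul (offDiag_analyticAt hD hDo hf hu hX hY K L _ k o))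

theorem offDiag_tripleProd (hD : IsFreeSet D) (hDo : IsOpenLevels D)
    (hf : IsRealFreeFunction D S u) (hu : IsPluriharmonic D u) {X : Matrix ι ι R}
    {Y : Matrix κ κ R} (hX : X ∈ extSet D ι) (hY : Y ∈ extSet D κ) (B : Matrix ι κ R)
    {U : Matrix ι ι ℂ} (hU : U ∈ Matrix.unitaryGroup ι ℂ) :
    offDiag u (tripleProd (star U) X U) Y (tripleProd (star U) B 1)
      = tripleProd (star U) (offDiag u X Y B) 1 := by
  have h := dirDeriv_tripleProd hDo hf hu (hD.fromBlocks_mem_extSet hX hY)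
    (Matrix.fromBlocks 0 B 0 0) (fromBlocks_unitary hU (one_mem (Matrix.unitaryGroup κ ℂ)))
  rw [tripleProd_star_fromBlocks, tripleProd_star_fromBlocks,
    ← Matrix.fromBlocks_toBlocks (dirDeriv u (Matrix.fromBlocks X 0 0 Y) _),
    tripleProd_star_fromBlocks] at h
  simp only [star_one, tripleProd_one_one, tripleProd_zero_mid] at h
  rw [offDiag, h]
  rfl

theorem offDiag_submatrix (hD : IsFreeSet D) (hDo : IsOpenLevels D)
    (hf : IsRealFreeFunction D S u) {X : Matrix ι ι R} {Y : Matrix κ κ R} (hX : X ∈ extSet D ι)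
    (hY : Y ∈ extSet D κ) (B : Matrix ι κ R) (e : ν ≃ ι) :
    offDiag u (X.submatrix e e) Y (B.submatrix e id) = (offDiag u X Y B).submatrix e id := by
  have h := dirDeriv_submatrix hD hDo hf (hD.fromBlocks_mem_extSet hX hY)
    (Matrix.fromBlocks 0 B 0 0) (e.sumCongr (Equiv.refl κ))
  have e1 : (Matrix.fromBlocks X 0 0 Y).submatrix (e.sumCongr (Equiv.refl κ))
      (e.sumCongr (Equiv.refl κ)) = Matrix.fromBlocks (X.submatrix e e) 0 0 Y := by
    ext (i | i) (j | j) <;> simp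
  have e2 : (Matrix.fromBlocks 0 B 0 0).submatrix (e.sumCongr (Equiv.refl κ))
      (e.sumCongr (Equiv.refl κ)) = Matrix.fromBlocks 0 (B.submatrix e id) 0 0 := by
    ext (i | i) (j | j) <;> simp
  rw [e1, e2] at h
  rw [offDiag, h]
  ext
  simp [offDiag, Matrix.toBlocks₁₂]

/-- After a permutation the base point is `(X ⊕ Y) ⊕ X'` and the direction lives in the first
summand, where `u` splits. -/
theorem offDiag_fromRows_zero (hD : IsFreeSet D) (hDo : IsOpenLevels D)
    (hf : IsRealFreeFunction D S u) {X : Matrix ι ι R} {X' : Matrix ν ν R}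
    {Y : Matrix κ κ R} (hX : X ∈ extSet D ι) (hX' : X' ∈ extSet D ν) (hY : Y ∈ extSet D κ)
    (B : Matrix ι κ R) :
    offDiag u (Matrix.fromBlocks X 0 0 X') Y (Matrix.fromRows B 0)
      = Matrix.fromRows (offDiag u X Y B) 0 := by
  set e : (ι ⊕ ν) ⊕ κ ≃ (ι ⊕ κ) ⊕ ν :=
    (Equiv.sumAssoc ι ν κ).trans (((Equiv.refl ι).sumCongr (Equiv.sumComm ν κ)).trans
      (Equiv.sumAssoc ι κ ν).symm) with he
  have h := dirDeriv_submatrix hD hDo hf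
    (hD.fromBlocks_mem_extSet (hD.fromBlocks_mem_extSet hX hY) hX')
    (Matrix.fromBlocks (Matrix.fromBlocks 0 B 0 0) 0 0 0) e
  rw [dirDeriv_fromBlocks hD hDo hf (hD.fromBlocks_mem_extSet hX hY) _ hX'] at h
  have e1 : (Matrix.fromBlocks (Matrix.fromBlocks X 0 0 Y) 0 0 X').submatrix e e
      = Matrix.fromBlocks (Matrix.fromBlocks X 0 0 X') 0 0 Y := by
    ext ((i | i) | i) ((j | j) | j) <;> simp [he]
  have e2 : (Matrix.fromBlocks (Matrix.fromBlocks 0 B 0 0) 0 0 (0 : Matrix ν ν R)).submatrix e e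
      = Matrix.fromBlocks 0 (Matrix.fromRows B 0) 0 0 := by
    ext ((i | i) | i) ((j | j) | j) <;> simp [he]
  rw [e1, e2] at h
  rw [offDiag, h]
  ext (i | i) j <;> simp [offDiag, Matrix.toBlocks₁₂, he]

theorem offDiag_zero_fromRows (hD : IsFreeSet D) (hDo : IsOpenLevels D)
    (hf : IsRealFreeFunction D S u) {X : Matrix ι ι R} {X' : Matrix ν ν R}
    {Y : Matrix κ κ R} (hX : X ∈ extSet D ι) (hX' : X' ∈ extSet D ν) (hY : Y ∈ extSet D κ)
    (B : Matrix ν κ R) :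
    offDiag u (Matrix.fromBlocks X 0 0 X') Y (Matrix.fromRows 0 B)
      = Matrix.fromRows 0 (offDiag u X' Y B) := by
  have h := offDiag_submatrix hD hDo hf (hD.fromBlocks_mem_extSet hX' hX) hY
    (Matrix.fromRows B 0) (Equiv.sumComm ι ν)
  rw [offDiag_fromRows_zero hD hDo hf hX' hX hY] at h
  have e1 : (Matrix.fromBlocks X' 0 0 X).submatrix (Equiv.sumComm ι ν) (Equiv.sumComm ι ν)
      = Matrix.fromBlocks X 0 0 X' := by
    ext (i | i) (j | j) <;> simp
  have e2 : (Matrix.fromRows B 0).submatrix (Equiv.sumComm ι ν) id = Matrix.fromRows 0 B := by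
    ext (i | i) j <;> simp
  rw [e1, e2] at h
  rw [h]
  ext (i | i) j <;> simp

theorem tripleProd_one_add_smul {R : Type*} [AddCommGroup R] [Module ℂ R] (X : Matrix ι ι R)
    (P : Matrix ι ι ℂ) {a b : ℂ} (hab : a * b = -a - b) :
    tripleProd (1 + b • P) X (1 + a • P) = X + a • (tripleProd 1 X P - tripleProd P X P)
      + b • (tripleProd P X 1 - tripleProd P X P) := by
  simp only [tripleProd_add_left, tripleProd_add_right, tripleProd_smul_left,
    tripleProd_smul_right, tripleProd_one_one]
  match_scalars <;> first | ring1 | linear_combination hab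

/-! ### Infinitesimal unitary equivariance. -/

/-- The derivative along a unitary orbit generated by a projection. -/
theorem dirDeriv_commutator_projection (hf : IsRealFreeFunction D S u)
    (hu : IsPluriharmonic D u) {X : Matrix ι ι R} (hX : X ∈ extSet D ι) {P : Matrix ι ι ℂ}
    (hP : P * P = P) (hPs : star P = P) :
    dirDeriv u X (twist X (I • P) X) = twist (extMap u ι X) (I • P) (extMap u ι X) := by
  ext i j
  set H := tripleProd 1 X P - tripleProd P X P
  set K := tripleProd P X 1 - tripleProd P X P
  set Z := extMap u ι X
  set H' := tripleProd 1 Z P - tripleProd P Z P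
  set K' := tripleProd P Z 1 - tripleProd P Z P
  -- For a projection, `exp(iθP) = 1 + (exp(iθ) - 1) P`. The orbit of `X` under these unitaries
  -- therefore stays in the affine slice spanned by `H` and `K`, where `u` is known to be
  -- differentiable.
  have hm : HasDerivAt (fun θ : ℝ => (cexp (θ * I) - 1, cexp (-(θ * I)) - 1)) (I, -I) (0 : ℝ) := by
    have h1 : HasDerivAt (fun θ : ℝ => (θ : ℂ) * I) I (0 : ℝ) := by
      simpa using (Complex.ofRealCLM.hasDerivAt (x := (0 : ℝ))).mul_const I
    have h2 := h1.cexp.sub_const 1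
    have h3 := h1.neg.cexp.sub_const 1
    simpa using h2.prodMk h3
  have key : ∀ θ : ℝ, extMap u ι (X + (cexp (θ * I) - 1) • H + (cexp (-(θ * I)) - 1) • K) i j
      = Z i j + (cexp (θ * I) - 1) • H' i j + (cexp (-(θ * I)) - 1) • K' i j := by
    intro θ
    set a := cexp (θ * I) - 1 with ha
    set b := cexp (-(θ * I)) - 1 with hb
    have hee : cexp (θ * I) * cexp (-(θ * I)) = 1 := by rw [← Complex.exp_add]; simp
    have hab : a * b = -a - b := by
      rw [ha, hb]; linear_combination hee
    have hab' : b * a = -b - a := by rw [mul_comm, hab]; ring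
    have hstar : star a = b := by
      simp only [ha, hb, star_sub, star_one, Complex.star_def, ← Complex.exp_conj, map_mul,
        conj_ofReal, conj_I, mul_neg]
    have hVs : star (1 + a • P) = 1 + b • P := by
      rw [star_add, star_one, star_smul, hPs, hstar]
    have hV : 1 + a • P ∈ Matrix.unitaryGroup ι ℂ := by
      rw [Matrix.mem_unitaryGroup_iff', hVs, add_mul, one_mul, mul_add, mul_one,
        smul_mul_smul_comm, hP, hab']
      module
    rw [← tripleProd_one_add_smul X P hab, ← hVs, hf.extMap_tripleProd hX hV, hVs,
      tripleProd_one_add_smul _ P hab]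
    rfl
  have hm0 : ((cexp ((0 : ℝ) * I) - 1, cexp (-((0 : ℝ) * I)) - 1) : ℂ × ℂ) = 0 := by simp
  have h1 := ((hu.extMap_contDiffAt hX H K i j).differentiableAt (by norm_num)).hasFDerivAt
  have h2 := h1
  rw [← hm0] at h2
  have h3 := HasFDerivAt.comp_hasDerivAt (f := fun θ : ℝ =>
    (cexp (θ * I) - 1, cexp (-(θ * I)) - 1)) (0 : ℝ) h2 hm
  rw [hm0, ← hu.dirDeriv_slice hX H K i j I (-I)] at h3
  have h4 : HasDerivAt (fun θ : ℝ => Z i j + (cexp (θ * I) - 1) • H' i j +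
      (cexp (-(θ * I)) - 1) • K' i j) (I • H' i j + (-I) • K' i j) (0 : ℝ) := by
    have a1 : HasDerivAt (fun θ : ℝ => cexp (θ * I) - 1) I (0 : ℝ) := hm.fst
    have a2 : HasDerivAt (fun θ : ℝ => cexp (-(θ * I)) - 1) (-I) (0 : ℝ) := hm.snd
    exact ((a1.smul_const (H' i j)).const_add (Z i j)).add (a2.smul_const (K' i j))
  have h5 := h3.unique (h4.congr_of_eventuallyEq (Filter.Eventually.of_forall key))
  rw [twist_smul_self_eq, twist_smul_self_eq]
  exact h5

/-- The derivative along the unitary orbit that mixes the two summands of a direct sum. -/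
theorem offDiag_twist_sub_star (hD : IsFreeSet D) (hDo : IsOpenLevels D)
    (hf : IsRealFreeFunction D S u) (hu : IsPluriharmonic D u) {X : Matrix ι ι R}
    {Y : Matrix κ κ R} (hX : X ∈ extSet D ι) (hY : Y ∈ extSet D κ) (i k : ι) (o : κ) :
    intertwine u X (Matrix.single i o 1) Y k o
        - star (intertwine u Y (Matrix.single o i 1) X o k)
      = extMap u ι X k i - if k = i then extMap u κ Y o o else 0 := by
  set Z := Matrix.fromBlocks X 0 0 Y
  have hZ : Z ∈ extSet D (ι ⊕ κ) := hD.fromBlocks_mem_extSet hX hY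
  set T : Matrix ι κ ℂ := Matrix.single i o 1 with hT
  set T' : Matrix κ ι ℂ := Matrix.single o i 1 with hT'
  have hTT' : T * T' = Matrix.single i i 1 := by simp [hT, hT']
  have hT'T : T' * T = Matrix.single o o 1 := by simp [hT, hT']
  have hTs : Tᴴ = T' := by simp [hT, hT']
  have hTs' : T'ᴴ = T := by simp [hT, hT']
  -- For `w = ±i` these are projections whose difference, times `i`, is the skew-adjoint generator
  -- with corners `T` and `-T*`. The rotation mixing the summands is thus reduced to the projection
  -- case.
  let P : ℂ → Matrix (ι ⊕ κ) (ι ⊕ κ) ℂ := fun w => (1 / 2 : ℂ) •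
    Matrix.fromBlocks (Matrix.single i i 1) (-w • T) (w • T') (Matrix.single o o 1)
  have hPP : ∀ w : ℂ, w * w = -1 → P w * P w = P w := by
    intro w hw
    have a1 : Matrix.single i i (1 : ℂ) * T = T := by simp [hT]
    have a2 : T * Matrix.single o o (1 : ℂ) = T := by simp [hT]
    have a3 : T' * Matrix.single i i (1 : ℂ) = T' := by simp [hT']
    have a4 : Matrix.single o o (1 : ℂ) * T' = T' := by simp [hT']
    have a5 : Matrix.single i i (1 : ℂ) * Matrix.single i i (1 : ℂ) = Matrix.single i i 1 := by simp
    have a6 : Matrix.single o o (1 : ℂ) * Matrix.single o o (1 : ℂ) = Matrix.single o o 1 := by simp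
    simp only [P, smul_mul_smul_comm, Matrix.fromBlocks_multiply, Matrix.smul_mul,
      Matrix.mul_smul, a1, a2, a3, a4, a5, a6, hTT', hT'T, smul_smul, neg_mul, mul_neg, hw,
      neg_neg, one_smul, ← two_smul ℂ]
    simp only [Matrix.fromBlocks_smul]
    congr 1 <;> module
  have hPs : ∀ w : ℂ, star w = -w → star (P w) = P w := by
    intro w hw
    simp only [P, star_smul, Matrix.star_eq_conjTranspose, Matrix.fromBlocks_conjTranspose,
      Matrix.conjTranspose_smul, hTs, hTs', hw, star_neg, neg_neg]
    simp
  have hI : star I = -I := by simp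
  have g1 := dirDeriv_commutator_projection hf hu hZ (hPP I I_mul_I) (hPs I hI)
  have g2 := dirDeriv_commutator_projection hf hu hZ (hPP (-I) (by simp)) (hPs (-I) (by simp))
  have hS : I • P I - I • P (-I) = Matrix.fromBlocks 0 T (-T') 0 := by
    simp only [P, Matrix.fromBlocks_smul, sub_eq_add_neg, Matrix.fromBlocks_neg,
      Matrix.fromBlocks_add, smul_smul]
    congr 1
    · module
    · match_scalars; linear_combination (-1 : ℂ) * I_mul_I
    · match_scalars; linear_combination I_mul_I
    · module
  have g3 : dirDeriv u Z (twist Z (Matrix.fromBlocks 0 T (-T') 0) Z)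
      = twist (extMap u _ Z) (Matrix.fromBlocks 0 T (-T') 0) (extMap u _ Z) := by
    rw [← hS, twist_sub_mid, twist_sub_mid, ← g1, ← g2, sub_eq_add_neg, hu.dirDeriv_add hZ,
      hu.dirDeriv_neg hZ, ← sub_eq_add_neg]
  have hneg : twist Y (-T') X = -twist Y T' X := by
    rw [← neg_one_smul ℂ T', twist_smul_mid, neg_one_smul]
  rw [hf.extMap_fromBlocks hD hX hY, twist_fromBlocks, twist_fromBlocks, hneg] at g3
  have hsplit : (Matrix.fromBlocks 0 (twist X T Y) (-twist Y T' X) 0 : Matrix (ι ⊕ κ) (ι ⊕ κ) R)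
      = Matrix.fromBlocks 0 (twist X T Y) 0 0 + -Matrix.fromBlocks 0 0 (twist Y T' X) 0 := by
    simp [Matrix.fromBlocks_neg, Matrix.fromBlocks_add]
  rw [hsplit, hu.dirDeriv_add hZ, hu.dirDeriv_neg hZ, ← sub_eq_add_neg] at g3
  -- A lower triangular direction also affects the upper right block, because derivatives of `u` are
  -- Hermitian: that block is the adjoint of the lower left one, which becomes a slope at `Y ⊕ X`
  -- once the summands are swapped.
  have hlow : dirDeriv u Z (Matrix.fromBlocks 0 0 (twist Y T' X) 0) (Sum.inl k) (Sum.inr o)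
      = star (intertwine u Y T' X o k) := by
    rw [← hu.star_dirDeriv hDo hZ]
    have h := dirDeriv_submatrix hD hDo hf hZ (Matrix.fromBlocks 0 0 (twist Y T' X) 0)
      (Equiv.sumComm κ ι)
    have e1 : Z.submatrix (Equiv.sumComm κ ι) (Equiv.sumComm κ ι) = Matrix.fromBlocks Y 0 0 X := by
      ext (i | i) (j | j) <;> simp [Z]
    have e2 : (Matrix.fromBlocks 0 0 (twist Y T' X) 0).submatrix (Equiv.sumComm κ ι)
        (Equiv.sumComm κ ι) = Matrix.fromBlocks 0 (twist Y T' X) 0 0 := by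
      ext (i | i) (j | j) <;> simp
    rw [e1, e2] at h
    rw [intertwine, offDiag, h]
    rfl
  have g4 := congrFun (congrFun g3 (Sum.inl k)) (Sum.inr o)
  rw [Matrix.sub_apply, hlow, Matrix.fromBlocks_apply₁₂] at g4
  refine Eq.trans g4 ?_
  rw [twist, Matrix.sub_apply, tripleProd_one_left, tripleProd_one_right]
  congr 1
  · rw [Finset.sum_eq_single i]
    · simp [hT]
    · intro l _ hl; simp [hT, hl.symm]
    · simp
  · rw [Finset.sum_eq_single o]
    · simp [hT, Matrix.single_apply, eq_comm]
    · intro l _ hl; simp [hT, hl.symm]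
    · simp

end Intertwine

/-! ### The correction term and its free equivariance. -/

/-- The matrix whose skew-adjoint part is added to `u` to form its analytic completion,
normalized at the entry `(o, o)` of the base point `Y`. -/
noncomputable def halfConjugate {R A : Type*} [AddCommGroup R] [Module ℂ R]
    [NonUnitalCStarAlgebra A] (u : GradedMap R A) {ι κ : Type} [Fintype ι] [Fintype κ]
    [DecidableEq ι] [DecidableEq κ] (Y : Matrix κ κ R) (o : κ) (X : Matrix ι ι R) :
    Matrix ι ι A :=
  Matrix.of fun k i => intertwine u X (Matrix.single i o 1) Y k o

section HalfConjugate

variable {R A : Type*} [AddCommGroup R] [Module ℂ R] [TopologicalSpace R]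
    [IsTopologicalAddGroup R] [ContinuousSMul ℂ R] [NonUnitalCStarAlgebra A]
    {S : Submodule ℂ A} {D : GradedSet R} {u : GradedMap R A}
    {ι κ ν : Type} [Fintype ι] [Fintype κ] [Fintype ν] [DecidableEq ι] [DecidableEq κ]
    [DecidableEq ν]

theorem intertwine_eq_sum (hD : IsFreeSet D) (hDo : IsOpenLevels D)
    (hf : IsRealFreeFunction D S u) (hu : IsPluriharmonic D u) {X : Matrix ι ι R}
    {Y : Matrix κ κ R} (hX : X ∈ extSet D ι) (hY : Y ∈ extSet D κ) (o : κ) (v : ι → ℂ) (b : ι) :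
    intertwine u X (∑ a, v a • Matrix.single a o 1) Y b o
      = ∑ a, v a • halfConjugate u Y o X b a := by
  let L : Matrix ι κ ℂ →ₗ[ℂ] Matrix ι κ A :=
    { toFun := fun T => intertwine u X T Y
      map_add' := fun T T' => by
        rw [intertwine, twist_add_mid, offDiag_add hD hu hX hY]; rfl
      map_smul' := fun z T => by
        rw [intertwine, twist_smul_mid, offDiag_smul hD hDo hf hu hX hY]; rfl }
  have h : L (∑ a, v a • Matrix.single a o 1) = ∑ a, v a • L (Matrix.single a o 1) := by
    rw [map_sum]
    simp only [map_smul]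
  have h2 := congrFun (congrFun h b) o
  rw [Matrix.sum_apply] at h2
  exact h2

/-- Conjugation by `U ⊕ 1` moves `X` and leaves `Y` fixed, turning `E_{io}` into `U E_{io}`;
linearity in `T` expands this as column `i` of `U`, which yields the right factor. -/
theorem halfConjugate_tripleProd (hD : IsFreeSet D) (hDo : IsOpenLevels D)
    (hf : IsRealFreeFunction D S u) (hu : IsPluriharmonic D u) {X : Matrix ι ι R}
    {Y : Matrix κ κ R} (hX : X ∈ extSet D ι) (hY : Y ∈ extSet D κ) (o : κ)
    {U : Matrix ι ι ℂ} (hU : U ∈ Matrix.unitaryGroup ι ℂ) :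
    halfConjugate u Y o (tripleProd (star U) X U)
      = tripleProd (star U) (halfConjugate u Y o X) U := by
  ext k i
  have h1 : U * Matrix.single i o (1 : ℂ) = ∑ a, U a i • Matrix.single a o (1 : ℂ) := by
    ext a c
    by_cases hc : c = o
    · subst hc
      simp [Matrix.sum_apply, Matrix.single_apply]
    · simp [Matrix.sum_apply, Ne.symm hc, hc]
  have h2 : twist (tripleProd (star U) X U) (Matrix.single i o 1) Y
      = tripleProd (star U) (twist X (U * Matrix.single i o (1 : ℂ)) Y) 1 := by
    rw [twist, twist, tripleProd_sub, tripleProd_tripleProd, tripleProd_tripleProd,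
      tripleProd_tripleProd, ← Matrix.mul_assoc (star U) U, Matrix.mem_unitaryGroup_iff'.1 hU]
    simp
  change offDiag u _ Y _ k o = _
  rw [h2, offDiag_tripleProd hD hDo hf hu hX hY _ hU, tripleProd_one_right, tripleProd_apply, h1]
  refine Finset.sum_congr rfl fun b _ => ?_
  have h3 := intertwine_eq_sum hD hDo hf hu hX hY o (fun a => U a i) b
  rw [intertwine] at h3
  rw [h3, Finset.smul_sum]
  simp only [smul_smul]

theorem halfConjugate_submatrix (hD : IsFreeSet D) (hDo : IsOpenLevels D)
    (hf : IsRealFreeFunction D S u) {X : Matrix ι ι R} {Y : Matrix κ κ R} (hX : X ∈ extSet D ι)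
    (hY : Y ∈ extSet D κ) (o : κ) (e : ν ≃ ι) :
    halfConjugate u Y o (X.submatrix e e) = (halfConjugate u Y o X).submatrix e e := by
  ext k i
  have h1 : twist (X.submatrix e e) (Matrix.single i o 1) Y
      = (twist X (Matrix.single (e i) o 1) Y).submatrix e id := by
    ext a c
    simp only [twist, Matrix.sub_apply, Matrix.submatrix_apply, tripleProd_one_left,
      tripleProd_one_right, id]
    congr 1
    · rw [← e.sum_comp]
      simp [Matrix.single_apply]
    · simp [Matrix.single_apply]
  rw [halfConjugate, Matrix.of_apply, intertwine, h1, offDiag_submatrix hD hDo hf hX hY]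
  rfl

theorem halfConjugate_fromBlocks (hD : IsFreeSet D) (hDo : IsOpenLevels D)
    (hf : IsRealFreeFunction D S u) {X : Matrix ι ι R} {X' : Matrix ν ν R}
    {Y : Matrix κ κ R} (hX : X ∈ extSet D ι) (hX' : X' ∈ extSet D ν) (hY : Y ∈ extSet D κ)
    (o : κ) :
    halfConjugate u Y o (Matrix.fromBlocks X 0 0 X')
      = Matrix.fromBlocks (halfConjugate u Y o X) 0 0 (halfConjugate u Y o X') := by
  have h1 : ∀ i : ι, twist (Matrix.fromBlocks X 0 0 X') (Matrix.single (Sum.inl i) o 1) Y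
      = Matrix.fromRows (twist X (Matrix.single i o 1) Y) 0 := by
    intro i
    ext (a | a) c <;> simp [twist, tripleProd_one_left, tripleProd_one_right, Matrix.single_apply]
  have h2 : ∀ i : ν, twist (Matrix.fromBlocks X 0 0 X') (Matrix.single (Sum.inr i) o 1) Y
      = Matrix.fromRows 0 (twist X' (Matrix.single i o 1) Y) := by
    intro i
    ext (a | a) c <;> simp [twist, tripleProd_one_left, tripleProd_one_right, Matrix.single_apply]
  ext k (i | i)
  · rw [halfConjugate, Matrix.of_apply, intertwine, h1, offDiag_fromRows_zero hD hDo hf hX hX' hY]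
    rcases k with k | k <;> rfl
  · rw [halfConjugate, Matrix.of_apply, intertwine, h2, offDiag_zero_fromRows hD hDo hf hX hX' hY]
    rcases k with k | k <;> rfl

/-- This is the form in which analyticity is visible: the adjoint of `offDiag_twist_sub_star`
cancels `u(X)` against the adjoint of the correction, and no adjoint of an `X`-dependent slope
remains. -/
theorem add_halfConjugate_sub_star (hD : IsFreeSet D) (hDo : IsOpenLevels D)
    (hf : IsRealFreeFunction D S u) (hu : IsPluriharmonic D u) {X : Matrix ι ι R}
    {Y : Matrix κ κ R} (hX : X ∈ extSet D ι) (hY : Y ∈ extSet D κ) (o : κ) (k i : ι) :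
    (extMap u ι X + (halfConjugate u Y o X - (halfConjugate u Y o X)ᴴ)) k i
      = intertwine u X (Matrix.single i o 1) Y k o - intertwine u Y (Matrix.single o k 1) X o i
        + if k = i then extMap u κ Y o o else 0 := by
  have h := congrArg star (offDiag_twist_sub_star hD hDo hf hu hX hY k i o)
  rw [star_sub, star_star, star_sub, hu.extMap_isHermitian hX] at h
  have h2 : star (if i = k then extMap u κ Y o o else 0)
      = if k = i then extMap u κ Y o o else 0 := by
    by_cases hki : k = i
    · simpa [hki] using hu.extMap_isHermitian hY o o
    · simp [hki, Ne.symm hki]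
  rw [h2] at h
  have h3 : star (intertwine u X (Matrix.single k o 1) Y i o)
      = extMap u ι X k i - (if k = i then extMap u κ Y o o else 0)
        + intertwine u Y (Matrix.single o k 1) X o i := by
    rw [← h]; abel
  simp only [Matrix.add_apply, Matrix.sub_apply, Matrix.conjTranspose_apply, halfConjugate,
    Matrix.of_apply, h3]
  abel

end HalfConjugate

/-! ### Assembly of the analytic completion. -/

theorem tripleProd_star_conjTranspose {A : Type*} [NonUnitalCStarAlgebra A] {ι : Type} [Fintype ι]
    (U : Matrix ι ι ℂ) (X : Matrix ι ι A) :
    (tripleProd (star U) X U)ᴴ = tripleProd (star U) Xᴴ U := by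
  ext i j
  simp only [Matrix.conjTranspose_apply, tripleProd_apply, star_sum, star_smul, star_mul,
    Matrix.star_apply, star_star]
  exact Finset.sum_comm

/-- Existence of the analytic completion. Connectedness is not needed: values at different points
are compared through direct sums, on which unitaries mix the summands. -/
theorem exists_analytic_completion {R₁ : Type*} [AddCommGroup R₁] [Module ℂ R₁]
    [TopologicalSpace R₁] [IsTopologicalAddGroup R₁] [ContinuousSMul ℂ R₁]
    {A : Type*} [NonUnitalCStarAlgebra A] (R₂ : Submodule ℂ A)
    (D : GradedSet R₁) (hD : IsFreeSet D) (hDopen : IsOpenLevels D)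
    (u : GradedMap R₁ A) (hu : IsRealFreeFunction D R₂ u) (hup : IsPluriharmonic D u) :
    ∃ f : GradedMap R₁ A, IsRealFreeFunction D R₂ f ∧ IsAnalyticOnLevels D f ∧
      ∀ n, ∀ Z ∈ D n, u n Z = rePart (f n Z) := by
  -- The construction needs a base point; over an empty domain `u` itself serves.
  by_cases hne : ∀ n, D n = ∅
  · refine ⟨u, hu, fun n => ?_, fun n Z hZ => ?_⟩
    · simp [hne n]
    · simp [hne n] at hZ
  push Not at hne
  obtain ⟨m, Y, hY⟩ := hne
  obtain ⟨o⟩ : Nonempty (Fin m) := by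
    rcases m with _ | m
    · rw [hD.level_zero] at hY
      exact absurd hY (Set.notMem_empty _)
    · infer_instance
  have hYe := hD.mem_extSet_fin.2 hY
  have hmem : ∀ {n : ℕ} {X : Matrix (Fin n) (Fin n) R₁}, X ∈ D n → X ∈ extSet D (Fin n) :=
    fun hX => hD.mem_extSet_fin.2 hX
  refine ⟨fun n X => u n X + (halfConjugate u Y o X - (halfConjugate u Y o X)ᴴ),
    ⟨fun n X hX i j => ?_, fun m n X hX X' hX' => ?_, fun n X hX V hV => ?_⟩,
    fun n => ⟨?_, fun Z hZ H i j => ?_⟩, fun n Z hZ => ?_⟩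
  · have h := fun k l => offDiag_mem_of_forall hD hDopen hu hup (hmem hX) hYe
      (twist X (Matrix.single k o 1) Y) l o
    exact R₂.add_mem (hu.entry_mem n X hX i j) (R₂.sub_mem (h j i).1 (h i j).2)
  · have h1 : dirSum X X' = (Matrix.fromBlocks X 0 0 X').submatrix finSumFinEquiv.symm
      finSumFinEquiv.symm := rfl
    have h2 : halfConjugate u Y o (dirSum X X')
        = dirSum (halfConjugate u Y o X) (halfConjugate u Y o X') := by
      rw [h1, halfConjugate_submatrix hD hDopen hu
        (hD.fromBlocks_mem_extSet (hmem hX) (hmem hX')) hYe,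
        halfConjugate_fromBlocks hD hDopen hu (hmem hX) (hmem hX') hYe]
      rfl
    simp only [h2, hu.map_dirSum m n X hX X' hX']
    ext i j
    obtain ⟨i, rfl⟩ := finSumFinEquiv.surjective i
    obtain ⟨j, rfl⟩ := finSumFinEquiv.surjective j
    rcases i with i | i <;> rcases j with j | j <;> simp [dirSum]
  · have h1 : halfConjugate u Y o (sandwich (star V) X V)
        = tripleProd (star V) (halfConjugate u Y o X) V :=
      halfConjugate_tripleProd hD hDopen hu hup (hmem hX) hYe o hV
    simp only [h1, tripleProd_star_conjTranspose, hu.map_unitary n X hX V hV]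
    change tripleProd (star V) (u n X) V + _ = tripleProd (star V) _ V
    rw [tripleProd_add, tripleProd_sub]
  · have h1 : ContinuousOn (fun X => halfConjugate u Y o X) (D n) := by
      refine continuousOn_pi.2 fun k => continuousOn_pi.2 fun i => ?_
      exact (intertwine_continuousOn hD hDopen hu hup (Matrix.single i o 1) hYe k o).mono
        fun X hX => hmem hX
    have h2 : Continuous fun X : Matrix (Fin n) (Fin n) A => Xᴴ :=
      continuous_id.matrix_conjTranspose
    exact (hup.continuousOn n).add (h1.sub (h2.comp_continuousOn h1))
  -- The base point is written as moving in the direction `0`, since `intertwine_analyticAt` varies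
  -- both of its arguments.
  · have h1 : (fun z : ℂ => (u n (Z + z • H) + (halfConjugate u Y o (Z + z • H)
        - (halfConjugate u Y o (Z + z • H))ᴴ)) i j) =ᶠ[𝓝 0] fun z =>
        intertwine u (Z + z • H) (Matrix.single j o 1) (Y + z • 0) i o
          - intertwine u (Y + z • 0) (Matrix.single o i 1) (Z + z • H) o j
          + if i = j then extMap u (Fin m) Y o o else 0 := by
      filter_upwards [eventually_add_smul_mem hDopen H (t := 0) (by simpa using hmem hZ)]
        with z hz
      rw [← hu.extMap_fin hD (hD.mem_extSet_fin.1 hz),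
        add_halfConjugate_sub_star hD hDopen hu hup hz hYe, smul_zero, add_zero]
    refine AnalyticAt.congr ?_ h1.symm
    exact ((intertwine_analyticAt hD hDopen hu hup (hmem hZ) hYe H 0 _ i o).sub
      (intertwine_analyticAt hD hDopen hu hup hYe (hmem hZ) 0 H _ o j)).add analyticAt_const
  · have h1 : (u n Z)ᴴ = u n Z := hup.isHermitian n Z hZ
    simp only [rePart, Matrix.conjTranspose_add, Matrix.conjTranspose_sub,
      Matrix.conjTranspose_conjTranspose, h1]
    module

end FreeAnalysis

theorem mainTheorem5 {R₁ : Type*} [AddCommGroup R₁] [Module ℂ R₁] [TopologicalSpace R₁]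
    [IsTopologicalAddGroup R₁] [ContinuousSMul ℂ R₁]
    {A : Type*} [NonUnitalCStarAlgebra A] (R₂ : Submodule ℂ A)
    (D : FreeAnalysis.GradedSet R₁) (hD : FreeAnalysis.IsFreeSet D)
    (hDopen : FreeAnalysis.IsOpenLevels D) (hDconn : FreeAnalysis.IsConnectedLevels D)
    (u : FreeAnalysis.GradedMap R₁ A) (hu : FreeAnalysis.IsRealFreeFunction D R₂ u)
    (hup : FreeAnalysis.IsPluriharmonic D u) :
    ∃ f : FreeAnalysis.GradedMap R₁ A,
      FreeAnalysis.IsRealFreeFunction D R₂ f ∧ FreeAnalysis.IsAnalyticOnLevels D f ∧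
        ∀ n, ∀ Z ∈ D n, u n Z = FreeAnalysis.rePart (f n Z) :=
  FreeAnalysis.exists_analytic_completion R₂ D hD hDopen u hu hup
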